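/- Lemma 4.7. Terminology. A weighted fan of dimension $k$ in $\mathbb{R}^n$ is a non-empty finite set $F$ of strongly convex rational cones (with respect to $\mathbb{Z}^n$), closed under taking faces, such that any two cones meet in a common face and all inclusion-maximal cones have dimension $k$, together with weights $\omega_F(\sigma)\in\mathbb{Z}_{\ge 0}$ on the set $F^{(k)}$ of its $k$-dimensional cones. For a cone $\sigma$ let $\langle\sigma\rangle$ be its linear span and $\mathbb{Z}_\sigma=\mathbb{Z}^n\cap\langle\sigma\rangle$; for a facet $\tau$ of $\sigma$ let $v_{\sigma/\tau}\in\mathbb{Z}_\sigma$ be a primitive generator from $\tau$ to $\sigma$, i.e. $\mathbb{Z}_\sigma=\mathbb{Z}_\tau+\mathbb{Z}v_{\sigma/\tau}$ and $v_{\sigma/\tau}\in\sigma+\langle\tau\rangle$. The fan is tropical if $\sum_{\sigma\in F^{(k)},\,\tau<\sigma}\omega_F(\sigma)v_{\sigma/\tau}\in\langle\tau\rangle$ for every $\tau\in F^{(k-1)}$. The support $|F|$ is the union of the $k$-dimensional cones of non-zero weight. A weighted fan $X$ refines a weighted fan $Y$ of the same dimension if $|X|=|Y|$ and every $k$-dimensional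 cone of $X$ of non-zero weight lies in a $k$-dimensional cone of $Y$ of the same weight; two tropical fans are equivalent if they have a common refinement; a $k$-cycle $[F]$ is an equivalence class of tropical fans of dimension $k$, and its support is $|F|$. A $0$-cycle is the origin with a multiplicity and is identified with that integer. For integral linear forms $l_0,\dots,l_r\in(\mathbb{Z}^n)^\vee$, the tropical regular function $T=\max(l_0,\dots,l_r):\mathbb{R}^n\to\mathbb{R}$ acts on $k$-cycles ($k\ge 1$) as follows: choose a representative $F$ such that on each cone $\sigma\in F$ the function $T$ agrees with a linear function $T_\sigma$ on $\langle\sigma\rangle$; then $T\cdot[F]$ is the $(k-1)$-cycle of the fan of all cones of $F$ of dimension at most $k-1$, with weights $$\omega_{T\cdot[F]}(\tau)=\sum_{\sigma\in F^{(k)},\,\tau<\sigma}T_\sigma\bigl(\omega_F(\sigma)v_{\sigma/\tau}\bigr)-T_\tau\Bigl(\sum_{\sigma\in F^{(k)},\,\tau<\sigma}\omega_F(\sigma)v_{\sigma/\tau}\Bigr),\qquad \tau\in F^{(k-1)}.$$ Statement. Let $0\le k\le n$, and let $v_1,\dots,v_k,w_1,\dots,w_{n-k}\in(\mathbb{Z}^n)^\vee$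 be linearly independent over $\mathbb{Z}$. Put $T_1=\max(0,v_1,\dots,v_k)$ and $T_2=\max(0,w_1,\dots,w_{n-k})$. Then: (a) there are only finitely many $2$-cycles $[L]$ in $\mathbb{R}^n$ whose support is a $2$-plane (a two-dimensional linear subspace of $\mathbb{R}^n$) and for which $T_1\cdot T_2\cdot[L]=0=T_1\cdot T_1\cdot[L]$ and $T_2\cdot T_2\cdot[L]=1$; (b) there is no $2$-cycle $[L]$ whose support is a $2$-plane and for which $T_1\cdot T_2\cdot[L]=T_1\cdot T_1\cdot[L]=T_2\cdot T_2\cdot[L]=0$; (c) there is no $2$-cycle $[L]$ whose support is a $2$-plane and for which $T_1\cdot T_2\cdot[L]=0$ and $T_1\cdot T_1\cdot[L]=1=T_2\cdot T_2\cdot[L]$. -/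

import Mathlib

/-! Affine tropical cycles in `ℝⁿ` and their intersection products with tropical regular functions.
The lattice `ℤⁿ` is `Fin n → ℤ`, and it sits in `ℝⁿ = Fin n → ℝ` coordinatewise. -/

namespace Tropical4

/-- The inclusion `ℤⁿ → ℝⁿ`. -/
def toReal (n : ℕ) : (Fin n → ℤ) →+ (Fin n → ℝ) where
  toFun z i := (z i : ℝ)
  map_zero' := by ext i; simp
  map_add' x y := by ext i; simp

/-- The linear span `⟨σ⟩` of a cone. -/
def linSpan {n : ℕ} (σ : PointedCone ℝ (Fin n → ℝ)) : Submodule ℝ (Fin n → ℝ) :=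
  Submodule.span ℝ (σ : Set (Fin n → ℝ))

/-- The dimension of a cone, i.e. the dimension of its linear span. -/
noncomputable def dim {n : ℕ} (σ : PointedCone ℝ (Fin n → ℝ)) : ℕ :=
  Module.finrank ℝ (linSpan σ)

/-- The lattice `ℤ_σ = ℤⁿ ∩ ⟨σ⟩`. -/
def lattice {n : ℕ} (σ : PointedCone ℝ (Fin n → ℝ)) : AddSubgroup (Fin n → ℤ) :=
  (linSpan σ).toAddSubgroup.comap (toReal n)

/-- `σ = Cone(S)` for a finite set `S ⊆ ℤⁿ`. -/
def IsRationalCone {n : ℕ} (σ : PointedCone ℝ (Fin n → ℝ)) : Prop :=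
  ∃ S : Finset (Fin n → ℤ), σ = PointedCone.hull ℝ (toReal n '' (S : Set (Fin n → ℤ)))

/-- `σ ∩ (-σ) = {0}`. -/
def IsStronglyConvex {n : ℕ} (σ : PointedCone ℝ (Fin n → ℝ)) : Prop :=
  ∀ x ∈ σ, -x ∈ σ → x = 0

/-- `v` is (a representative of) the primitive generator `v_{σ/τ}` from `τ` to `σ`: it lies in
`ℤ_σ`, it generates `ℤ_σ` modulo `ℤ_τ`, and it points from `⟨τ⟩` towards `σ`. Meant for `τ` a
facet of `σ`, where such a `v` is unique modulo `ℤ_τ`. -/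
def IsPrimitiveGenerator {n : ℕ} (τ σ : PointedCone ℝ (Fin n → ℝ)) (v : Fin n → ℤ) : Prop :=
  v ∈ lattice σ ∧ lattice τ ⊔ AddSubgroup.zmultiples v = lattice σ ∧
    ∃ t ∈ linSpan τ, toReal n v + t ∈ σ

/-- A weighted fan of dimension `k` in `ℝⁿ`: a finite non-empty set of strongly convex rational
cones, closed under faces, any two of which meet in a common face, all of whose maximal cones have
dimension `k`, with weights in `ℤ_{≥0}` on the cones of dimension `k`. The values of `weight`
elsewhere have no meaning and are never used. -/
structure WeightedFan (n k : ℕ) where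
  cones : Finset (PointedCone ℝ (Fin n → ℝ))
  nonempty : cones.Nonempty
  rational : ∀ σ ∈ cones, IsRationalCone σ
  stronglyConvex : ∀ σ ∈ cones, IsStronglyConvex σ
  face_mem : ∀ σ ∈ cones, ∀ τ : PointedCone ℝ (Fin n → ℝ), τ.IsFaceOf σ → τ ∈ cones
  inter_face : ∀ σ₁ ∈ cones, ∀ σ₂ ∈ cones,
    (σ₁ ⊓ σ₂).IsFaceOf σ₁ ∧ (σ₁ ⊓ σ₂).IsFaceOf σ₂
  pure : ∀ σ ∈ cones, (∀ σ' ∈ cones, σ ≤ σ' → σ' = σ) → dim σ = k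
  weight : PointedCone ℝ (Fin n → ℝ) → ℕ

namespace WeightedFan

variable {n k : ℕ}

/-- The set `F^{(k)}` of the facets (top-dimensional cones). -/
noncomputable def facets (F : WeightedFan n k) : Finset (PointedCone ℝ (Fin n → ℝ)) := by
  classical exact F.cones.filter (fun σ => dim σ = k)

/-- The facets `σ` with `τ < σ`. Cones of a fan that are comparable by inclusion are faces of each
other, so for a cone `τ` of the fan these are the facets having `τ` as a proper face. -/
noncomputable def star (F : WeightedFan n k) (τ : PointedCone ℝ (Fin n → ℝ)) :
    Finset (PointedCone ℝ (Fin n → ℝ)) := by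
  classical exact F.facets.filter (fun σ => τ < σ)

/-- The support of a weighted fan: the union of its facets of non-zero weight. -/
def support (F : WeightedFan n k) : Set (Fin n → ℝ) :=
  {x | ∃ σ ∈ F.facets, F.weight σ ≠ 0 ∧ x ∈ σ}

/-- A choice of primitive generators `v σ = v_{σ/τ}` for all facets `σ > τ`. -/
def IsNormalChoice (F : WeightedFan n k) (τ : PointedCone ℝ (Fin n → ℝ))
    (v : PointedCone ℝ (Fin n → ℝ) → (Fin n → ℤ)) : Prop :=
  ∀ σ ∈ F.star τ, IsPrimitiveGenerator τ σ (v σ)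

/-- The balancing condition at each cone `τ` of codimension one:
`∑_{σ > τ} ω(σ) v_{σ/τ} = 0` modulo `⟨τ⟩`. -/
def IsBalanced (F : WeightedFan n k) : Prop :=
  ∀ τ ∈ F.cones, dim τ + 1 = k → ∃ v : PointedCone ℝ (Fin n → ℝ) → (Fin n → ℤ),
    F.IsNormalChoice τ v ∧ toReal n (∑ σ ∈ F.star τ, F.weight σ • v σ) ∈ linSpan τ

/-- `X` refines `Y`. As usual, cones that lie in no facet of non-zero weight are discarded: the
supports agree, and each facet of `X` of non-zero weight lies in a facet of `Y` of the same
weight. -/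
def Refines (X Y : WeightedFan n k) : Prop :=
  X.support = Y.support ∧ ∀ σ ∈ X.facets, X.weight σ ≠ 0 →
    ∃ σ' ∈ Y.facets, σ ≤ σ' ∧ Y.weight σ' = X.weight σ

end WeightedFan

/-- A tropical fan of dimension `k` in `ℝⁿ`: a balanced weighted fan. -/
structure TropicalFan (n k : ℕ) extends WeightedFan n k where
  balanced : toWeightedFan.IsBalanced

/-- Two tropical fans are equivalent if they have a common refinement. (A refinement of a balanced
weighted fan is again balanced.) -/
def TropicalFan.Equivalent {n k : ℕ} (F G : TropicalFan n k) : Prop :=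
  ∃ X : WeightedFan n k, X.Refines F.toWeightedFan ∧ X.Refines G.toWeightedFan

/-- Affine tropical `k`-cycles in `ℝⁿ`: equivalence classes of tropical fans. -/
def Cycle (n k : ℕ) : Type := Quot (TropicalFan.Equivalent (n := n) (k := k))

/-- The class `[F]`. -/
def TropicalFan.cycle {n k : ℕ} (F : TropicalFan n k) : Cycle n k := Quot.mk _ F

/-- The support `|F|` of a cycle `[F]`. -/
def Cycle.support {n k : ℕ} : Cycle n k → Set (Fin n → ℝ) :=
  Quot.lift (fun F => F.toWeightedFan.support) (by
    rintro F G ⟨X, hF, hG⟩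
    exact hF.1.symm.trans hG.1)

theorem dim_bot {n : ℕ} : dim (⊥ : PointedCone ℝ (Fin n → ℝ)) = 0 := by
  have h : linSpan (⊥ : PointedCone ℝ (Fin n → ℝ)) = ⊥ :=
    (Submodule.span_eq_bot).2 (fun x hx => hx)
  rw [dim, h, finrank_bot]

theorem eq_bot_of_dim_eq_zero {n : ℕ} {σ : PointedCone ℝ (Fin n → ℝ)} (h : dim σ = 0) :
    σ = ⊥ := by
  have h1 : linSpan σ = ⊥ := Submodule.finrank_eq_zero.mp h
  rw [eq_bot_iff]
  intro x hx
  have h2 : x ∈ linSpan σ := Submodule.subset_span hx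
  rw [h1] at h2
  exact h2

theorem WeightedFan.mem_facets_zero {n : ℕ} (F : WeightedFan n 0)
    (σ : PointedCone ℝ (Fin n → ℝ)) : σ ∈ F.facets ↔ σ = ⊥ := by
  have key : ∀ τ ∈ F.facets, τ = ⊥ := by
    intro τ hτ
    simp only [WeightedFan.facets, Finset.mem_filter] at hτ
    exact eq_bot_of_dim_eq_zero hτ.2
  constructor
  · exact key σ
  · rintro rfl
    obtain ⟨τ, hτ⟩ := F.cones.exists_maximal F.nonempty
    have hd : dim τ = 0 := F.pure τ hτ.1 (fun σ' h h' => le_antisymm (hτ.2 h h') h')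
    have hb := eq_bot_of_dim_eq_zero hd
    simp only [WeightedFan.facets, Finset.mem_filter]
    exact ⟨hb ▸ hτ.1, dim_bot⟩

theorem WeightedFan.Refines.weight_bot {n : ℕ} {X Y : WeightedFan n 0} (h : X.Refines Y) :
    X.weight ⊥ = Y.weight ⊥ := by
  by_cases hX : X.weight ⊥ = 0
  · by_contra hne
    have h0 : (0 : Fin n → ℝ) ∈ Y.support :=
      ⟨⊥, (Y.mem_facets_zero ⊥).2 rfl, fun h' => hne (hX.trans h'.symm), zero_mem _⟩
    rw [← h.1] at h0
    obtain ⟨σ, hσ, hw, -⟩ := h0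
    rw [X.mem_facets_zero] at hσ
    exact hw (hσ ▸ hX)
  · obtain ⟨σ', hσ', -, hw⟩ := h.2 ⊥ ((X.mem_facets_zero ⊥).2 rfl) hX
    rw [Y.mem_facets_zero] at hσ'
    rw [← hw, hσ']

/-- A `0`-cycle is the origin with a multiplicity; this is the multiplicity. -/
def Cycle.degree {n : ℕ} : Cycle n 0 → ℕ :=
  Quot.lift (fun F => F.weight ⊥) (by
    rintro F G ⟨X, hF, hG⟩
    exact hF.weight_bot.symm.trans hG.weight_bot)

/-- The real-valued linear form on `ℝⁿ` that extends `l ∈ (ℤⁿ)^∨`. -/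
noncomputable def realForm {n : ℕ} (l : Module.Dual ℤ (Fin n → ℤ)) :
    Module.Dual ℝ (Fin n → ℝ) :=
  ∑ i, (l (Pi.single i 1) : ℝ) • LinearMap.proj i

/-- Tropical regular functions on `ℝⁿ`: maxima of finitely many integral linear forms. -/
structure TRFunction (n : ℕ) where
  toFun : (Fin n → ℝ) → ℝ
  exists_max : ∃ (s : Finset (Module.Dual ℤ (Fin n → ℤ))) (hs : s.Nonempty),
    ∀ x, toFun x = s.sup' hs (fun l => realForm l x)

/-- The tropical regular function `max(l₀, …, l_r)`. -/
noncomputable def TRFunction.max {n r : ℕ} (l : Fin (r + 1) → Module.Dual ℤ (Fin n → ℤ)) :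
    TRFunction n where
  toFun x := Finset.univ.sup' Finset.univ_nonempty (fun i => realForm (l i) x)
  exists_max := by
    classical
    refine ⟨Finset.univ.image l, Finset.univ_nonempty.image l, fun x => ?_⟩
    rw [Finset.sup'_image]
    rfl

/-- `G` is the fan `(⋃_{i ≤ k} F^{(i)}, ω_{T·F})`, where `T` is linear on each cone `σ` of `F`, with
linear extension `T_σ`, and
`ω_{T·F}(τ) = ∑_{σ > τ} T_σ(ω(σ) v_{σ/τ}) - T_τ(∑_{σ > τ} ω(σ) v_{σ/τ})` for `dim τ = k`.
Only the values of `T_σ` on `⟨σ⟩` matter; they are determined by `T`. -/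
def IsFanProduct {n k : ℕ} (T : TRFunction n) (F : TropicalFan n (k + 1)) (G : TropicalFan n k) :
    Prop :=
  (∀ τ, τ ∈ G.cones ↔ τ ∈ F.cones ∧ dim τ ≤ k) ∧
  ∃ T' : PointedCone ℝ (Fin n → ℝ) → Module.Dual ℝ (Fin n → ℝ),
    (∀ σ ∈ F.cones, ∀ x ∈ σ, T.toFun x = T' σ x) ∧
    ∀ τ ∈ F.cones, dim τ = k → ∃ v : PointedCone ℝ (Fin n → ℝ) → (Fin n → ℤ),
      F.IsNormalChoice τ v ∧
      (G.weight τ : ℝ) = ∑ σ ∈ F.star τ, T' σ (toReal n (F.weight σ • v σ))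
        - T' τ (toReal n (∑ σ ∈ F.star τ, F.weight σ • v σ))

/-- `D = T · C`, computed on a representative of `C` on each cone of which `T` is linear. (The
intersection product does not depend on the choices, so this is the graph of `C ↦ T · C`.) -/
def IsProduct {n k : ℕ} (T : TRFunction n) (C : Cycle n (k + 1)) (D : Cycle n k) : Prop :=
  ∃ (F : TropicalFan n (k + 1)) (G : TropicalFan n k),
    F.cycle = C ∧ G.cycle = D ∧ IsFanProduct T F G

/-- `S · T · C = d` for a `2`-cycle `C`: the product `S · (T · C)` is the origin with
multiplicity `d`. -/
def HasIntersectionNumber {n : ℕ} (S T : TRFunction n) (C : Cycle n 2) (d : ℕ) : Prop :=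
  ∃ (D : Cycle n 1) (E : Cycle n 0), IsProduct T C D ∧ IsProduct S D E ∧ E.degree = d

/-- The support of the cycle is a `2`-plane (a linear subspace of dimension two). -/
def Cycle.SupportIsPlane {n : ℕ} (C : Cycle n 2) : Prop :=
  ∃ P : Submodule ℝ (Fin n → ℝ), Module.finrank ℝ P = 2 ∧ C.support = (P : Set (Fin n → ℝ))

end Tropical4

namespace Tropical4

/-! ### Cones -/

/-! Let `P` be the support of `L`. The rays of non-zero weight of `T · L` make up, away from the
origin, the corner locus of `T` on `P`: the points near which `T` is not linear on `P`. The number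
`S · T · L` is the sum of `ω(ρ) S(u_ρ)` over these rays, where `∑ ω(ρ) u_ρ = 0`
(`HasIntersectionNumber.exists_rays`). For `S = max(0, l₁, …)` every term is non-negative. If the
number is zero, each `lᵢ` is therefore `≤ 0` on every ray, and balancing makes it vanish there
(`HasIntersectionNumber.realForm_eq_zero`). By independence, the `vᵢ` and `wⱼ` together have no
common zero but the origin.

For (b), all forms vanish on the corner locus of `T₂`, which is thus empty. Then `T₂` is linear on
the connected set `P ∖ {0}`, and comparing `x` with `-x` kills every `wⱼ` on `P`. The same argument
for `T₁` kills every `vᵢ`, so `P = 0`.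

For (c), the corner locus of `T₂` contains some `u ≠ 0`, and all `vᵢ` vanish at `u`. On `P` they
factor through the line `P/⟨u⟩`, so the corner locus of `T₁` lies in `⟨u⟩`, where `T₁ = 0`. This
gives `T₁ · T₁ · L = 0`.

For (a), the generators of the corner locus of `T₂` are lattice vectors killed by all `vᵢ`, with
`|wⱼ| ≤ 1`. There are finitely many such vectors, and those on the corner locus span `P`
(`exists_span_smallVectors`), so finitely many planes occur. The weight of `L` is a constant
dividing the intersection number `1`, and a cycle of weight one is determined by its plane
(`TropicalFan.cycle_eq`); the common refinement comes from a line arrangement. -/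

theorem mem_hull_iff {n : ℕ} {S : Finset (Fin n → ℤ)} {x : Fin n → ℝ} :
    x ∈ PointedCone.hull ℝ (toReal n '' (S : Set (Fin n → ℤ))) ↔
      ∃ c : (Fin n → ℤ) → ℝ, (∀ s, 0 ≤ c s) ∧ x = ∑ s ∈ S, c s • toReal n s := by
  rw [PointedCone.hull, Submodule.mem_span_image_finset_iff_exists_fun]
  constructor
  · rintro ⟨c, rfl⟩
    classical
    refine ⟨fun s => if h : s ∈ S then c ⟨s, h⟩ else 0, fun s => ?_, ?_⟩
    · dsimp only
      split_ifs
      · exact (c _).2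
      · exact le_rfl
    · refine Eq.trans ?_ (Finset.sum_coe_sort S _)
      refine Finset.sum_congr rfl fun s _ => ?_
      simp only [Finset.coe_mem, dif_pos]
      rfl
  · rintro ⟨c, hc, rfl⟩
    exact ⟨fun s => ⟨c s, hc s⟩, Finset.sum_coe_sort S fun s => c s • toReal n s⟩

theorem toReal_injective (n : ℕ) : Function.Injective (toReal n) := by
  intro x y h
  ext i
  have := congrFun h i
  simpa [toReal] using this

theorem toReal_mem_hull {n : ℕ} {S : Finset (Fin n → ℤ)} {s : Fin n → ℤ} (hs : s ∈ S) :
    toReal n s ∈ PointedCone.hull ℝ (toReal n '' (S : Set (Fin n → ℤ))) :=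
  PointedCone.subset_hull ⟨s, hs, rfl⟩

theorem mem_linSpan {n : ℕ} {σ : PointedCone ℝ (Fin n → ℝ)} {x : Fin n → ℝ} (hx : x ∈ σ) :
    x ∈ linSpan σ := Submodule.subset_span hx

theorem mem_linSpan_iff {n : ℕ} {σ : PointedCone ℝ (Fin n → ℝ)} {x : Fin n → ℝ} :
    x ∈ linSpan σ ↔ ∃ a ∈ σ, ∃ b ∈ σ, x = a - b := by
  constructor
  · intro hx
    induction hx using Submodule.span_induction with
    | mem x h => exact ⟨x, h, 0, zero_mem _, by simp⟩
    | zero => exact ⟨0, zero_mem _, 0, zero_mem _, by simp⟩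
    | add x y _ _ hx hy =>
      obtain ⟨a, ha, b, hb, rfl⟩ := hx
      obtain ⟨c, hc, d, hd, rfl⟩ := hy
      exact ⟨a + c, add_mem ha hc, b + d, add_mem hb hd, by abel⟩
    | smul r x _ hx =>
      obtain ⟨a, ha, b, hb, rfl⟩ := hx
      rcases le_total 0 r with hr | hr
      · exact ⟨r • a, σ.smul_mem hr ha, r • b, σ.smul_mem hr hb, by rw [smul_sub]⟩
      · exact ⟨(-r) • b, σ.smul_mem (by linarith) hb, (-r) • a, σ.smul_mem (by linarith) ha, by
          module⟩
  · rintro ⟨a, ha, b, hb, rfl⟩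
    exact sub_mem (mem_linSpan ha) (mem_linSpan hb)

theorem linSpan_mono {n : ℕ} {σ τ : PointedCone ℝ (Fin n → ℝ)} (h : σ ≤ τ) :
    linSpan σ ≤ linSpan τ := Submodule.span_mono h

theorem linSpan_hull {n : ℕ} (S : Finset (Fin n → ℤ)) :
    linSpan (PointedCone.hull ℝ (toReal n '' (S : Set (Fin n → ℤ)))) =
      Submodule.span ℝ (toReal n '' (S : Set (Fin n → ℤ))) := by
  apply le_antisymm
  · exact Submodule.span_le.2 (PointedCone.hull_le_span ℝ _)
  · exact Submodule.span_mono PointedCone.subset_hull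

/-- With equal spans, a point of `σ` is a difference `a - b` of points of `τ`. Adding `b` lands in
`τ`, so the face property applies. -/
theorem eq_of_isFaceOf_of_dim_le {n : ℕ} {τ σ : PointedCone ℝ (Fin n → ℝ)} (h : τ.IsFaceOf σ)
    (hd : dim σ ≤ dim τ) : τ = σ := by
  have hs : linSpan τ = linSpan σ := Submodule.eq_of_le_of_finrank_le (linSpan_mono h.le) hd
  refine le_antisymm h.le fun z hz => ?_
  have hz' : z ∈ linSpan τ := hs ▸ mem_linSpan hz
  obtain ⟨a, ha, b, hb, rfl⟩ := mem_linSpan_iff.1 hz'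
  exact h.mem_of_add_mem_left hz (h.le hb) (by simpa using ha)

theorem dim_pos_of_mem {n : ℕ} {σ : PointedCone ℝ (Fin n → ℝ)} {x : Fin n → ℝ} (hx : x ∈ σ)
    (h0 : x ≠ 0) : 0 < dim σ := by
  by_contra h
  have := eq_bot_of_dim_eq_zero (Nat.eq_zero_of_not_pos h)
  subst this
  exact h0 hx

theorem exists_ne_zero_of_dim_pos {n : ℕ} {σ : PointedCone ℝ (Fin n → ℝ)} (hσ : 0 < dim σ)
    (hr : IsRationalCone σ) : ∃ z : Fin n → ℤ, toReal n z ∈ σ ∧ z ≠ 0 := by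
  obtain ⟨S, rfl⟩ := hr
  by_contra! h
  have : linSpan (PointedCone.hull ℝ (toReal n '' (S : Set (Fin n → ℤ)))) = ⊥ := by
    rw [linSpan_hull, Submodule.span_eq_bot]
    rintro _ ⟨s, hs, rfl⟩
    rw [h s (toReal_mem_hull hs), map_zero]
  rw [dim, this, finrank_bot] at hσ
  exact lt_irrefl _ hσ

theorem linSpan_eq_span_singleton {n : ℕ} {τ : PointedCone ℝ (Fin n → ℝ)} (hτ : dim τ = 1)
    {u : Fin n → ℝ} (hu : u ∈ τ) (h0 : u ≠ 0) : linSpan τ = Submodule.span ℝ {u} := by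
  symm
  apply Submodule.eq_of_le_of_finrank_le
  · exact (Submodule.span_singleton_le_iff_mem _ _).2 (mem_linSpan hu)
  · rw [finrank_span_singleton h0]; exact hτ.le

theorem mem_ray_iff {n : ℕ} {τ : PointedCone ℝ (Fin n → ℝ)} (hτ : dim τ = 1)
    (hs : IsStronglyConvex τ) {u : Fin n → ℝ} (hu : u ∈ τ) (h0 : u ≠ 0) {x : Fin n → ℝ} :
    x ∈ τ ↔ ∃ c : ℝ, 0 ≤ c ∧ x = c • u := by
  constructor
  · intro hx
    have := mem_linSpan hx
    rw [linSpan_eq_span_singleton hτ hu h0, Submodule.mem_span_singleton] at this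
    obtain ⟨c, rfl⟩ := this
    rcases le_total 0 c with hc | hc
    · exact ⟨c, hc, rfl⟩
    · have h1 : c • u = 0 := hs _ hx (by
        rw [← neg_smul]; exact τ.smul_mem (by linarith) hu)
      exact ⟨0, le_rfl, by rw [h1, zero_smul]⟩
  · rintro ⟨c, hc, rfl⟩
    exact τ.smul_mem hc hu

theorem linSpan_le_of_le {n : ℕ} {σ : PointedCone ℝ (Fin n → ℝ)} {P : Submodule ℝ (Fin n → ℝ)}
    (h : ∀ x ∈ σ, x ∈ P) : linSpan σ ≤ P := Submodule.span_le.2 h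

theorem linSpan_eq_of_le {n : ℕ} {σ : PointedCone ℝ (Fin n → ℝ)} {P : Submodule ℝ (Fin n → ℝ)}
    (h : ∀ x ∈ σ, x ∈ P) (hd : Module.finrank ℝ P = dim σ) : linSpan σ = P :=
  Submodule.eq_of_le_of_finrank_le (linSpan_le_of_le h) hd.le

/-- The cone consists of the non-negative multiples of the convex hull `K` of its non-zero
generators, together with `0`. Strong convexity keeps `0` out of the compact set `K`, so multiples
of bounded norm have bounded scalars. -/
theorem IsStronglyConvex.isClosed {n : ℕ} {σ : PointedCone ℝ (Fin n → ℝ)}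
    (hs : IsStronglyConvex σ) (hr : IsRationalCone σ) : IsClosed (σ : Set (Fin n → ℝ)) := by
  classical
  obtain ⟨S, hS⟩ := hr
  set A : Finset (Fin n → ℝ) := (S.image (toReal n)).erase 0 with hA
  have hAσ : ∀ a ∈ A, a ∈ σ := by
    intro a ha
    obtain ⟨s, hs, rfl⟩ := Finset.mem_image.1 (Finset.mem_of_mem_erase ha)
    rw [hS]; exact toReal_mem_hull hs
  set K : Set (Fin n → ℝ) := convexHull ℝ (A : Set (Fin n → ℝ)) with hK
  have hKc : IsCompact K := Set.Finite.isCompact_convexHull ℝ A.finite_toSet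
  have hKσ : ∀ x ∈ K, x ∈ σ := fun x hx => convexHull_min hAσ σ.convex hx
  have h0 : (0 : Fin n → ℝ) ∉ K := by
    intro h
    rw [hK, Finset.mem_convexHull'] at h
    obtain ⟨w, hw, hw1, hw2⟩ := h
    have hex : ∃ a ∈ A, 0 < w a := by
      by_contra! hc
      have : ∑ y ∈ A, w y ≤ 0 := Finset.sum_nonpos hc
      linarith
    obtain ⟨a, ha, hwa⟩ := hex
    rw [← Finset.add_sum_erase _ _ ha] at hw2
    have h1 : -(w a • a) ∈ σ := by
      rw [neg_eq_of_add_eq_zero_right hw2]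
      exact sum_mem fun y hy => σ.smul_mem (hw y (Finset.mem_of_mem_erase hy))
        (hAσ y (Finset.mem_of_mem_erase hy))
    have h2 := hs (w a • a) (σ.smul_mem hwa.le (hAσ a ha)) h1
    rcases smul_eq_zero.1 h2 with h3 | h3
    · exact hwa.ne' h3
    · exact (Finset.ne_of_mem_erase ha) h3
  have hcone : ∀ x ∈ σ, x ≠ 0 → ∃ c : ℝ, 0 ≤ c ∧ ∃ k ∈ K, x = c • k := by
    intro x hx hx0
    rw [hS, mem_hull_iff] at hx
    obtain ⟨c, hc, rfl⟩ := hx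
    set B := S.filter (fun s => s ≠ 0)
    have hB : ∑ s ∈ S, c s • toReal n s = ∑ s ∈ B, c s • toReal n s := by
      rw [Finset.sum_filter_of_ne]
      rintro s - h rfl
      simp at h
    rw [hB] at hx0 ⊢
    have hpos : 0 < ∑ s ∈ B, c s := by
      apply lt_of_le_of_ne (Finset.sum_nonneg fun s _ => hc s)
      intro h
      rw [eq_comm, Finset.sum_eq_zero_iff_of_nonneg fun s _ => hc s] at h
      exact hx0 (Finset.sum_eq_zero fun s hs => by rw [h s hs, zero_smul])
    refine ⟨∑ s ∈ B, c s, hpos.le, B.centerMass c (toReal n), ?_, ?_⟩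
    · apply Finset.centerMass_mem_convexHull _ (fun s _ => hc s) hpos
      intro s hs
      simp only [B, Finset.mem_filter] at hs
      simp only [hA, Finset.coe_erase, Finset.coe_image]
      refine ⟨⟨s, hs.1, rfl⟩, fun h => hs.2 (toReal_injective n ?_)⟩
      simpa using h
    · rw [Finset.centerMass, smul_smul, mul_inv_cancel₀ hpos.ne', one_smul]
  rcases K.eq_empty_or_nonempty with hKe | hKn
  · have : (σ : Set (Fin n → ℝ)) = {0} := by
      ext x
      refine ⟨fun hx => ?_, ?_⟩
      · by_contra hne
        obtain ⟨c, -, k, hk, -⟩ := hcone x hx hne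
        simp [hKe] at hk
      · rintro rfl; exact zero_mem σ
    rw [this]; exact isClosed_singleton
  obtain ⟨k₀, hk₀, hmin⟩ := hKc.exists_isMinOn hKn continuous_norm.continuousOn
  have hδ : 0 < ‖k₀‖ := norm_pos_iff.2 fun h => h0 (h ▸ hk₀)
  apply isClosed_of_closure_subset
  intro y hy
  by_cases hy0 : y = 0
  · rw [hy0]; exact zero_mem σ
  have hyp : 0 < ‖y‖ := norm_pos_iff.2 hy0
  -- Points of the ball of radius `‖y‖` about `y` have norm below `2‖y‖`, and `‖k₀‖` is the least
  -- norm on `K`. This bounds the scalar.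
  set K' : Set (Fin n → ℝ) := (fun p : ℝ × (Fin n → ℝ) => p.1 • p.2) ''
    (Set.Icc 0 (2 * ‖y‖ / ‖k₀‖) ×ˢ K)
  have hK' : IsCompact K' := (isCompact_Icc.prod hKc).image (by fun_prop)
  have hK'σ : K' ⊆ σ := by
    rintro _ ⟨⟨c, k⟩, ⟨hc, hk⟩, rfl⟩
    exact σ.smul_mem hc.1 (hKσ k hk)
  have hy' : y ∈ closure ((σ : Set (Fin n → ℝ)) ∩ Metric.ball y ‖y‖) :=
    Metric.isOpen_ball.closure_inter ⟨hy, Metric.mem_ball_self hyp⟩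
  refine hK'σ (hK'.isClosed.closure_subset_iff.2 ?_ hy')
  rintro x ⟨hx, hxb⟩
  rw [mem_ball_iff_norm] at hxb
  have hx0 : x ≠ 0 := by
    rintro rfl
    simp at hxb
  obtain ⟨c, hc, k, hk, rfl⟩ := hcone x hx hx0
  refine ⟨(c, k), ⟨⟨hc, ?_⟩, hk⟩, rfl⟩
  have h1 : ‖c • k‖ ≤ ‖c • k - y‖ + ‖y‖ := by simpa using norm_add_le (c • k - y) y
  rw [norm_smul, Real.norm_of_nonneg hc] at h1
  have h2 : c * ‖k₀‖ ≤ c * ‖k‖ := mul_le_mul_of_nonneg_left (hmin hk) hc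
  rw [le_div_iff₀ hδ]
  linarith

/-! ### Primitive generators and the balancing condition -/

theorem toReal_zsmul {n : ℕ} (k : ℤ) (z : Fin n → ℤ) :
    toReal n (k • z) = (k : ℝ) • toReal n z := by
  rw [map_zsmul, Int.cast_smul_eq_zsmul]

theorem toReal_nsmul {n : ℕ} (k : ℕ) (z : Fin n → ℤ) :
    toReal n (k • z) = (k : ℝ) • toReal n z := by
  rw [map_nsmul, Nat.cast_smul_eq_nsmul]

theorem IsPrimitiveGenerator.exists_eq {n : ℕ} {τ σ : PointedCone ℝ (Fin n → ℝ)} {v : Fin n → ℤ}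
    (hv : IsPrimitiveGenerator τ σ v) {z : Fin n → ℤ} (hz : toReal n z ∈ linSpan σ) :
    ∃ t ∈ linSpan τ, ∃ k : ℤ, toReal n z = t + (k : ℝ) • toReal n v := by
  have hz' : z ∈ lattice τ ⊔ AddSubgroup.zmultiples v := by rw [hv.2.1]; exact hz
  obtain ⟨a, ha, b, hb, rfl⟩ := AddSubgroup.mem_sup.1 hz'
  obtain ⟨k, rfl⟩ := AddSubgroup.mem_zmultiples_iff.1 hb
  exact ⟨toReal n a, ha, k, by rw [map_add, toReal_zsmul]⟩

theorem IsPrimitiveGenerator.linSpan_le {n : ℕ} {τ σ : PointedCone ℝ (Fin n → ℝ)}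
    {v : Fin n → ℤ} (hv : IsPrimitiveGenerator τ σ v) (hσ : IsRationalCone σ) :
    linSpan σ ≤ linSpan τ ⊔ Submodule.span ℝ {toReal n v} := by
  obtain ⟨S, hS⟩ := hσ
  conv_lhs => rw [hS, linSpan_hull]
  rw [Submodule.span_le]
  rintro _ ⟨s, hs, rfl⟩
  obtain ⟨t, ht, k, hk⟩ := hv.exists_eq (z := s)
    (mem_linSpan (by rw [hS]; exact toReal_mem_hull hs))
  rw [hk]
  exact Submodule.add_mem_sup ht (Submodule.smul_mem _ _ (Submodule.mem_span_singleton_self _))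

theorem IsPrimitiveGenerator.notMem_linSpan {n : ℕ} {τ σ : PointedCone ℝ (Fin n → ℝ)}
    {v : Fin n → ℤ} (hv : IsPrimitiveGenerator τ σ v) (hσ : IsRationalCone σ)
    (hd : dim τ < dim σ) : toReal n v ∉ linSpan τ := by
  intro h
  have h1 := hv.linSpan_le hσ
  rw [sup_eq_left.2 ((Submodule.span_singleton_le_iff_mem _ _).2 h)] at h1
  exact absurd (Submodule.finrank_mono h1) (not_le.2 hd)

/-- Both vectors generate the same lattice modulo `⟨τ⟩`, since `lattice` depends only on the span.
The integers expressing each through the other multiply to `1`, hence are both `1` or both `-1`. -/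
theorem IsPrimitiveGenerator.congr {n : ℕ} {τ σ₁ σ₂ : PointedCone ℝ (Fin n → ℝ)}
    {v₁ v₂ : Fin n → ℤ} (h₁ : IsPrimitiveGenerator τ σ₁ v₁) (h₂ : IsPrimitiveGenerator τ σ₂ v₂)
    (h : linSpan σ₁ = linSpan σ₂) (hv : toReal n v₁ ∉ linSpan τ) :
    toReal n v₁ - toReal n v₂ ∈ linSpan τ ∨ toReal n v₁ + toReal n v₂ ∈ linSpan τ := by
  obtain ⟨t, ht, k, hk⟩ := h₁.exists_eq (z := v₂) (by rw [h]; exact h₂.1)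
  obtain ⟨t', ht', k', hk'⟩ := h₂.exists_eq (z := v₁) (by rw [← h]; exact h₁.1)
  have h1 : ((1 : ℝ) - k' * k) • toReal n v₁ ∈ linSpan τ := by
    have : ((1 : ℝ) - k' * k) • toReal n v₁ = t' + (k' : ℝ) • t := by
      have h2 : toReal n v₁ = t' + (k' : ℝ) • (t + (k : ℝ) • toReal n v₁) := by rw [← hk, ← hk']
      rw [sub_smul, one_smul, mul_smul]
      nth_rewrite 1 [h2]
      rw [smul_add]
      abel
    rw [this]
    exact add_mem ht' (Submodule.smul_mem _ _ ht)
  have h2 : (1 : ℝ) - k' * k = 0 := by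
    by_contra hne
    exact hv ((Submodule.smul_mem_iff _ hne).1 h1)
  have h3 : k' * k = 1 := by
    have : (k' : ℝ) * k = 1 := by linarith
    exact_mod_cast this
  rcases Int.eq_one_or_neg_one_of_mul_eq_one' h3 with ⟨-, hk1⟩ | ⟨-, hk1⟩
  · left
    rw [hk, hk1]
    have : toReal n v₁ - (t + ((1 : ℤ) : ℝ) • toReal n v₁) = -t := by push_cast; module
    rw [this]
    exact neg_mem ht
  · right
    rw [hk, hk1]
    have : toReal n v₁ + (t + ((-1 : ℤ) : ℝ) • toReal n v₁) = t := by push_cast; module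
    rw [this]
    exact ht

/-- The opposite sign is excluded by convexity: two points of `σ`, one on each side of `⟨τ⟩`, would,
after adding a point of `τ`, sum to a point of `τ`. The face property would then put the first of
them in `τ`. -/
theorem IsPrimitiveGenerator.sub_mem {n : ℕ} {τ σ : PointedCone ℝ (Fin n → ℝ)}
    {v₁ v₂ : Fin n → ℤ} (h₁ : IsPrimitiveGenerator τ σ v₁) (h₂ : IsPrimitiveGenerator τ σ v₂)
    (hf : τ.IsFaceOf σ) (hv : toReal n v₁ ∉ linSpan τ) :
    toReal n v₁ - toReal n v₂ ∈ linSpan τ := by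
  refine (h₁.congr h₂ rfl hv).resolve_right fun h => hv ?_
  obtain ⟨t₁, ht₁, hσ₁⟩ := h₁.2.2
  obtain ⟨t₂, ht₂, hσ₂⟩ := h₂.2.2
  obtain ⟨p, hp, q, hq, hpq⟩ := mem_linSpan_iff.1 (add_mem h (add_mem ht₁ ht₂))
  have h3 : toReal n v₁ + t₁ ∈ τ := by
    refine hf.mem_of_add_mem_left hσ₁ (add_mem hσ₂ (hf.le hq)) ?_
    have : toReal n v₁ + t₁ + (toReal n v₂ + t₂ + q) = p := by
      have : toReal n v₁ + t₁ + (toReal n v₂ + t₂ + q) =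
        toReal n v₁ + toReal n v₂ + (t₁ + t₂) + q := by abel
      rw [this, hpq, sub_add_cancel]
    rw [this]
    exact hp
  simpa using _root_.sub_mem (mem_linSpan h3) ht₁

namespace WeightedFan

variable {n k : ℕ}

theorem mem_facets {F : WeightedFan n k} {σ : PointedCone ℝ (Fin n → ℝ)} :
    σ ∈ F.facets ↔ σ ∈ F.cones ∧ dim σ = k := by
  simp [facets]

theorem mem_star {F : WeightedFan n k} {τ σ : PointedCone ℝ (Fin n → ℝ)} :
    σ ∈ F.star τ ↔ σ ∈ F.facets ∧ τ < σ := by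
  simp [star]

theorem isFaceOf_of_le (F : WeightedFan n k) {τ σ : PointedCone ℝ (Fin n → ℝ)}
    (hτ : τ ∈ F.cones) (hσ : σ ∈ F.cones) (h : τ ≤ σ) : τ.IsFaceOf σ := by
  have := (F.inter_face τ hτ σ hσ).2
  rwa [inf_eq_left.2 h] at this

theorem toReal_sum (F : WeightedFan n k) (s : Finset (PointedCone ℝ (Fin n → ℝ)))
    (v : PointedCone ℝ (Fin n → ℝ) → (Fin n → ℤ)) :
    toReal n (∑ σ ∈ s, F.weight σ • v σ) = ∑ σ ∈ s, (F.weight σ : ℝ) • toReal n (v σ) := by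
  rw [map_sum]
  exact Finset.sum_congr rfl fun σ _ => toReal_nsmul _ _

theorem IsNormalChoice.notMem_linSpan {F : WeightedFan n k} {τ : PointedCone ℝ (Fin n → ℝ)}
    {v : PointedCone ℝ (Fin n → ℝ) → (Fin n → ℤ)} (hv : F.IsNormalChoice τ v)
    (hd : dim τ + 1 = k) {σ : PointedCone ℝ (Fin n → ℝ)} (hσ : σ ∈ F.star τ) :
    toReal n (v σ) ∉ linSpan τ := by
  have h := mem_facets.1 (mem_star.1 hσ).1
  exact (hv σ hσ).notMem_linSpan (F.rational σ h.1) (by omega)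

/-- Balancing supplies one choice of generators and a product formula may use another; changing the
choice moves the sum only within `⟨τ⟩`. -/
theorem IsBalanced.sum_mem {F : WeightedFan n k} (hF : F.IsBalanced)
    {τ : PointedCone ℝ (Fin n → ℝ)} (hτ : τ ∈ F.cones) (hd : dim τ + 1 = k)
    {v : PointedCone ℝ (Fin n → ℝ) → (Fin n → ℤ)} (hv : F.IsNormalChoice τ v) :
    ∑ σ ∈ F.star τ, (F.weight σ : ℝ) • toReal n (v σ) ∈ linSpan τ := by
  obtain ⟨v', hv', h⟩ := hF τ hτ hd
  rw [toReal_sum] at h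
  have : ∑ σ ∈ F.star τ, (F.weight σ : ℝ) • toReal n (v σ) =
      ∑ σ ∈ F.star τ, (F.weight σ : ℝ) • toReal n (v' σ) +
      ∑ σ ∈ F.star τ, (F.weight σ : ℝ) • (toReal n (v σ) - toReal n (v' σ)) := by
    rw [← Finset.sum_add_distrib]
    exact Finset.sum_congr rfl fun σ _ => by module
  rw [this]
  refine add_mem h (_root_.sum_mem fun σ hσ => Submodule.smul_mem _ _ ?_)
  have hσ' := mem_facets.1 (mem_star.1 hσ).1
  exact (hv σ hσ).sub_mem (hv' σ hσ) (F.isFaceOf_of_le hτ hσ'.1 (mem_star.1 hσ).2.le)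
    (hv.notMem_linSpan hd hσ)

theorem bot_mem (F : WeightedFan n k) : ⊥ ∈ F.cones := by
  obtain ⟨σ, hσ⟩ := F.nonempty
  refine F.face_mem σ hσ ⊥ ⟨bot_le, fun {x y a} hx hy ha h => ?_⟩
  have h1 : a • x + y = 0 := h
  have h2 : a • x = 0 := F.stronglyConvex σ hσ _ (σ.smul_mem ha.le hx) (by
    rwa [neg_eq_of_add_eq_zero_right h1])
  exact (smul_eq_zero.1 h2).resolve_left ha.ne'

/-- The facets of non-zero weight. -/
noncomputable def activeFacets (F : WeightedFan n k) : Finset (PointedCone ℝ (Fin n → ℝ)) :=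
  F.facets.filter fun σ => F.weight σ ≠ 0

theorem mem_activeFacets {F : WeightedFan n k} {σ : PointedCone ℝ (Fin n → ℝ)} :
    σ ∈ F.activeFacets ↔ (σ ∈ F.cones ∧ dim σ = k) ∧ F.weight σ ≠ 0 := by
  simp [activeFacets, mem_facets]

theorem activeFacets_mem_star {F : WeightedFan n k} {τ σ : PointedCone ℝ (Fin n → ℝ)}
    (hσ : σ ∈ F.activeFacets) (h : τ < σ) : σ ∈ F.star τ :=
  mem_star.2 ⟨mem_facets.2 (mem_activeFacets.1 hσ).1, h⟩

theorem mem_support_iff {F : WeightedFan n k} {x : Fin n → ℝ} :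
    x ∈ F.support ↔ ∃ σ ∈ F.activeFacets, x ∈ σ := by
  simp [support, activeFacets, and_assoc]

theorem isClosed_of_mem (F : WeightedFan n k) {σ : PointedCone ℝ (Fin n → ℝ)}
    (hσ : σ ∈ F.cones) : IsClosed (σ : Set (Fin n → ℝ)) :=
  (F.stronglyConvex σ hσ).isClosed (F.rational σ hσ)

-- The cones are closed and finite in number. This local statement feeds the connectedness
-- arguments.
open Filter Topology in
theorem eventually_mem_imp_mem (F : WeightedFan n k) (x : Fin n → ℝ) :
    ∀ᶠ y in 𝓝 x, ∀ σ ∈ F.cones, y ∈ σ → x ∈ σ := by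
  rw [Finset.eventually_all]
  intro σ hσ
  by_cases h : x ∈ σ
  · exact Eventually.of_forall fun _ _ => h
  · filter_upwards [(F.isClosed_of_mem hσ).isOpen_compl.mem_nhds h] with y hy hy'
    exact absurd hy' hy

end WeightedFan

/-! ### Fans whose support is a plane -/

theorem two_le_dim {n : ℕ} {σ : PointedCone ℝ (Fin n → ℝ)} {u x : Fin n → ℝ} (hu : u ∈ σ)
    (hx : x ∈ σ) (h0 : u ≠ 0) (h : x ∉ Submodule.span ℝ {u}) : 2 ≤ dim σ := by
  have hli : LinearIndependent ℝ ![u, x] := by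
    rw [LinearIndependent.pair_iff' h0]
    intro a ha
    exact h (ha ▸ Submodule.smul_mem _ _ (Submodule.mem_span_singleton_self _))
  have h1 : Submodule.span ℝ (Set.range ![u, x]) ≤ linSpan σ := by
    rw [Submodule.span_le]
    rintro _ ⟨i, rfl⟩
    fin_cases i
    · exact mem_linSpan hu
    · exact mem_linSpan hx
  have h2 := Submodule.finrank_mono h1
  rwa [finrank_span_eq_card hli, Fintype.card_fin] at h2

namespace WeightedFan

variable {n : ℕ} {F : WeightedFan n 2} {P : Submodule ℝ (Fin n → ℝ)}

theorem mem_plane (hP : F.support = P) {σ : PointedCone ℝ (Fin n → ℝ)} (hσ : σ ∈ F.activeFacets)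
    {x : Fin n → ℝ} (hx : x ∈ σ) : x ∈ P := by
  have : x ∈ F.support := mem_support_iff.2 ⟨σ, hσ, hx⟩
  rwa [hP] at this

theorem linSpan_activeFacet (hP : F.support = P) (hP2 : Module.finrank ℝ P = 2)
    {σ : PointedCone ℝ (Fin n → ℝ)} (hσ : σ ∈ F.activeFacets) : linSpan σ = P :=
  linSpan_eq_of_le (fun _ hx => mem_plane hP hσ hx)
    (by rw [hP2, (mem_activeFacets.1 hσ).1.2])

theorem exists_activeFacet (hP : F.support = P) {x : Fin n → ℝ} (hx : x ∈ P) :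
    ∃ σ ∈ F.activeFacets, x ∈ σ := by
  rw [← mem_support_iff, hP]
  exact hx

/-- The ray is `σ₁ ⊓ σ₂`: as a common face of distinct facets it has dimension below two, and it
contains `x ≠ 0`. -/
theorem exists_ray_of_mem_of_mem {σ₁ σ₂ : PointedCone ℝ (Fin n → ℝ)} (h₁ : σ₁ ∈ F.facets)
    (h₂ : σ₂ ∈ F.facets) (hne : σ₁ ≠ σ₂) {x : Fin n → ℝ} (hx : x ≠ 0) (hx₁ : x ∈ σ₁)
    (hx₂ : x ∈ σ₂) : ∃ τ ∈ F.cones, dim τ = 1 ∧ x ∈ τ ∧ τ < σ₁ ∧ τ < σ₂ := by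
  rw [mem_facets] at h₁ h₂
  obtain ⟨f₁, f₂⟩ := F.inter_face σ₁ h₁.1 σ₂ h₂.1
  have hlt : dim (σ₁ ⊓ σ₂) < 2 := by
    by_contra! h
    exact hne ((eq_of_isFaceOf_of_dim_le f₁ (by omega)).symm.trans
      (eq_of_isFaceOf_of_dim_le f₂ (by omega)))
  have hpos := dim_pos_of_mem (σ := σ₁ ⊓ σ₂) ⟨hx₁, hx₂⟩ hx
  refine ⟨σ₁ ⊓ σ₂, F.face_mem σ₁ h₁.1 _ f₁, by omega, ⟨hx₁, hx₂⟩,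
    lt_of_le_of_ne f₁.le ?_, lt_of_le_of_ne f₂.le ?_⟩
  · intro h; rw [h] at hlt; omega
  · intro h; rw [h] at hlt; omega

/-- Two facets containing `u` and reaching to the same side of its line overlap in dimension two:
according to the sign of `α`, either `b` or `a` lies in both. -/
theorem eq_of_same_side {σ₁ σ₂ : PointedCone ℝ (Fin n → ℝ)} (h₁ : σ₁ ∈ F.facets)
    (h₂ : σ₂ ∈ F.facets) {u a b : Fin n → ℝ} (hu : u ≠ 0) (hu₁ : u ∈ σ₁) (hu₂ : u ∈ σ₂)
    (ha : a ∈ σ₁) (hb : b ∈ σ₂) (hau : a ∉ Submodule.span ℝ {u}) {α β : ℝ} (hβ : 0 < β)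
    (hab : b = α • u + β • a) : σ₁ = σ₂ := by
  rw [mem_facets] at h₁ h₂
  obtain ⟨f₁, f₂⟩ := F.inter_face σ₁ h₁.1 σ₂ h₂.1
  have key : 2 ≤ dim (σ₁ ⊓ σ₂) := by
    rcases le_total 0 α with hα | hα
    · refine two_le_dim (u := u) (x := b) ⟨hu₁, hu₂⟩ ⟨?_, hb⟩ hu ?_
      · rw [hab]
        exact add_mem (σ₁.smul_mem hα hu₁) (σ₁.smul_mem hβ.le ha)
      · intro h
        refine hau ((Submodule.smul_mem_iff _ hβ.ne').1 ?_)
        have : β • a = b - α • u := by rw [hab]; abel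
        rw [this]
        exact sub_mem h (Submodule.smul_mem _ _ (Submodule.mem_span_singleton_self _))
    · refine two_le_dim (u := u) (x := a) ⟨hu₁, hu₂⟩ ⟨ha, ?_⟩ hu hau
      have : a = β⁻¹ • (b + (-α) • u) := by
        rw [hab]
        have : α • u + β • a + -α • u = β • a := by module
        rw [this, smul_smul, inv_mul_cancel₀ hβ.ne', one_smul]
      rw [this]
      exact σ₂.smul_mem (inv_nonneg.2 hβ.le) (add_mem hb (σ₂.smul_mem (by linarith) hu₂))
  exact (eq_of_isFaceOf_of_dim_le f₁ (by omega)).symm.trans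
    (eq_of_isFaceOf_of_dim_le f₂ (by omega))

theorem exists_mem_notMem_span {σ : PointedCone ℝ (Fin n → ℝ)} (h : 2 ≤ dim σ)
    (u : Fin n → ℝ) : ∃ a ∈ σ, a ∉ Submodule.span ℝ {u} := by
  by_contra! hc
  have h1 := Submodule.finrank_mono (linSpan_le_of_le hc)
  have h2 := finrank_span_le_card (R := ℝ) ({u} : Set (Fin n → ℝ))
  rw [Set.toFinset_card, Fintype.card_unique] at h2
  rw [dim] at h
  omega

theorem exists_eq_add_smul (hP2 : Module.finrank ℝ P = 2) {u a b : Fin n → ℝ} (hu : u ≠ 0)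
    (huP : u ∈ P) (haP : a ∈ P) (hbP : b ∈ P) (hau : a ∉ Submodule.span ℝ {u}) :
    ∃ α β : ℝ, b = α • u + β • a := by
  have hli : LinearIndependent ℝ ![u, a] := by
    rw [LinearIndependent.pair_iff' hu]
    intro c hc
    exact hau (hc ▸ Submodule.smul_mem _ _ (Submodule.mem_span_singleton_self _))
  have h : Submodule.span ℝ (Set.range ![u, a]) = P := by
    apply Submodule.eq_of_le_of_finrank_le
    · rw [Submodule.span_le]
      rintro _ ⟨i, rfl⟩
      fin_cases i
      · exact huP
      · exact haP
    · rw [finrank_span_eq_card hli, Fintype.card_fin, hP2]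
  rw [← h, Submodule.mem_span_range_iff_exists_fun] at hbP
  obtain ⟨c, hc⟩ := hbP
  exact ⟨c 0, c 1, by rw [← hc, Fin.sum_univ_two]; rfl⟩

/-- The line through the ray cuts `P` into two half-planes, and by `eq_of_same_side` each holds at
most one active facet at the ray. -/
theorem eq_or_eq_of_ray (hP : F.support = P) (hP2 : Module.finrank ℝ P = 2)
    {τ σ₁ σ₂ σ₃ : PointedCone ℝ (Fin n → ℝ)} (hτ1 : dim τ = 1) (hτ : τ ∈ F.cones)
    (h₁ : σ₁ ∈ F.activeFacets)
    (h₂ : σ₂ ∈ F.activeFacets) (h₃ : σ₃ ∈ F.activeFacets) (hτ₁ : τ < σ₁) (hτ₂ : τ < σ₂)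
    (hτ₃ : τ < σ₃) (hne : σ₁ ≠ σ₂) : σ₃ = σ₁ ∨ σ₃ = σ₂ := by
  obtain ⟨z, hz, hz0⟩ := exists_ne_zero_of_dim_pos (by omega) (F.rational τ hτ)
  set u := toReal n z
  have hu : u ≠ 0 := fun h => hz0 (toReal_injective n (by rw [map_zero]; exact h))
  have m₁ := mem_activeFacets.1 h₁
  have m₂ := mem_activeFacets.1 h₂
  have m₃ := mem_activeFacets.1 h₃
  obtain ⟨a₁, ha₁, hu₁⟩ := exists_mem_notMem_span m₁.1.2.ge u
  obtain ⟨a₂, ha₂, hu₂⟩ := exists_mem_notMem_span m₂.1.2.ge u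
  obtain ⟨a₃, ha₃, hu₃⟩ := exists_mem_notMem_span m₃.1.2.ge u
  have huP : u ∈ P := mem_plane hP h₁ (hτ₁.le hz)
  have neg : ∀ {a b : Fin n → ℝ} {α β : ℝ}, b ∉ Submodule.span ℝ {u} → b = α • u + β • a →
      β ≠ 0 := by
    rintro a b α β hb rfl rfl
    refine hb (add_mem (Submodule.smul_mem _ _ (Submodule.mem_span_singleton_self _)) ?_)
    rw [zero_smul]; exact zero_mem _
  obtain ⟨α, β, hαβ⟩ := exists_eq_add_smul hP2 hu huP (mem_plane hP h₁ ha₁)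
    (mem_plane hP h₂ ha₂) hu₁
  obtain ⟨γ, δ, hγδ⟩ := exists_eq_add_smul hP2 hu huP (mem_plane hP h₁ ha₁)
    (mem_plane hP h₃ ha₃) hu₁
  have hβ : β < 0 := by
    refine lt_of_le_of_ne (not_lt.1 fun h => hne ?_) (neg hu₂ hαβ)
    exact eq_of_same_side (mem_facets.2 m₁.1) (mem_facets.2 m₂.1) hu (hτ₁.le hz) (hτ₂.le hz)
      ha₁ ha₂ hu₁ h hαβ
  rcases lt_or_gt_of_ne (neg hu₃ hγδ) with hδ | hδ
  · right
    symm
    refine eq_of_same_side (α := γ - δ / β * α) (β := δ / β) (mem_facets.2 m₂.1)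
      (mem_facets.2 m₃.1) hu (hτ₂.le hz) (hτ₃.le hz)
      ha₂ ha₃ hu₂ (div_pos_of_neg_of_neg hδ hβ) ?_
    rw [hγδ, hαβ, smul_add, smul_smul (δ / β) β, div_mul_cancel₀ _ hβ.ne]
    module
  · left
    symm
    exact eq_of_same_side (mem_facets.2 m₁.1) (mem_facets.2 m₃.1) hu (hτ₁.le hz) (hτ₃.le hz)
      ha₁ ha₃ hu₁ hδ hγδ

theorem sum_star_eq_of_ray (hP : F.support = P) (hP2 : Module.finrank ℝ P = 2)
    {τ σ₁ σ₂ : PointedCone ℝ (Fin n → ℝ)} (hτ1 : dim τ = 1) (hτ : τ ∈ F.cones)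
    (h₁ : σ₁ ∈ F.activeFacets) (h₂ : σ₂ ∈ F.activeFacets) (hτ₁ : τ < σ₁) (hτ₂ : τ < σ₂)
    (hne : σ₁ ≠ σ₂) {M : Type*} [AddCommMonoid M] (f : PointedCone ℝ (Fin n → ℝ) → M)
    (hf : ∀ σ, F.weight σ = 0 → f σ = 0) : ∑ σ ∈ F.star τ, f σ = f σ₁ + f σ₂ := by
  classical
  rw [← Finset.sum_pair hne]
  symm
  apply Finset.sum_subset
  · intro σ hσ
    rw [Finset.mem_insert, Finset.mem_singleton] at hσ
    rcases hσ with rfl | rfl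
    · exact activeFacets_mem_star h₁ hτ₁
    · exact activeFacets_mem_star h₂ hτ₂
  · intro σ hσ hn
    apply hf
    by_contra h
    rw [mem_star, mem_facets] at hσ
    refine hn ?_
    rw [Finset.mem_insert, Finset.mem_singleton]
    exact eq_or_eq_of_ray hP hP2 hτ1 hτ h₁ h₂ (mem_activeFacets.2 ⟨hσ.1, h⟩) hτ₁ hτ₂ hσ.2 hne

theorem le_linSpan_sup (hP : F.support = P) (hP2 : Module.finrank ℝ P = 2)
    {τ σ : PointedCone ℝ (Fin n → ℝ)} (h : σ ∈ F.activeFacets)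
    {v : Fin n → ℤ} (hv : IsPrimitiveGenerator τ σ v) :
    P ≤ linSpan τ ⊔ Submodule.span ℝ {toReal n v} := by
  rw [← linSpan_activeFacet hP hP2 h]
  exact hv.linSpan_le (F.rational σ (mem_activeFacets.1 h).1.1)

end WeightedFan

open Filter Topology

/-! ### Local linearity on a subspace -/

/-- On a neighbourhood of `x` in `P` the function `T` agrees with a linear form. -/
def LocallyLinearAt {n : ℕ} (T : (Fin n → ℝ) → ℝ) (P : Submodule ℝ (Fin n → ℝ))
    (x : Fin n → ℝ) : Prop :=
  ∃ f : Module.Dual ℝ (Fin n → ℝ), ∀ᶠ y in 𝓝[P] x, T y = f y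

theorem exists_pos_of_eventually {n : ℕ} {P : Submodule ℝ (Fin n → ℝ)} {x z : Fin n → ℝ}
    (hx : x ∈ P) (hz : z ∈ P) {p : (Fin n → ℝ) → Prop} (h : ∀ᶠ y in 𝓝[P] x, p y) :
    ∃ t : ℝ, 0 < t ∧ p (x + t • z) := by
  have h1 : Tendsto (fun t : ℝ => x + t • z) (𝓝[>] 0) (𝓝[P] x) := by
    apply tendsto_nhdsWithin_of_tendsto_nhds_of_eventually_within
    · have : Continuous (fun t : ℝ => x + t • z) := by fun_prop
      have h2 := this.tendsto 0
      rw [zero_smul, add_zero] at h2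
      exact h2.mono_left nhdsWithin_le_nhds
    · exact Eventually.of_forall fun t => P.add_mem hx (P.smul_mem t hz)
  obtain ⟨t, ht, ht'⟩ := ((h1.eventually h).and self_mem_nhdsWithin).exists
  exact ⟨t, ht', ht⟩

theorem dual_eq_of_eventually {n : ℕ} {P : Submodule ℝ (Fin n → ℝ)} {x : Fin n → ℝ}
    {f g : Module.Dual ℝ (Fin n → ℝ)} (hx : x ∈ P) (h : ∀ᶠ y in 𝓝[P] x, f y = g y)
    {z : Fin n → ℝ} (hz : z ∈ P) : f z = g z := by
  obtain ⟨t, ht, h1⟩ := exists_pos_of_eventually hx hz h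
  have h0 : f x = g x := h.self_of_nhdsWithin hx
  rw [map_add, map_add, map_smul, map_smul, h0, smul_eq_mul, smul_eq_mul] at h1
  exact mul_left_cancel₀ ht.ne' (add_left_cancel h1)

/-- The local linear form is unique on `P`, because an open subset of `P` determines it. Having a
common local form is therefore a transitive, locally satisfied relation, and connectedness spreads
it over `U`. -/
theorem exists_dual_of_locallyLinearAt {n : ℕ} {T : (Fin n → ℝ) → ℝ}
    {P : Submodule ℝ (Fin n → ℝ)} {U : Set (Fin n → ℝ)} (hU : IsPreconnected U)
    (hUP : U ⊆ P) (hT : ∀ x ∈ U, LocallyLinearAt T P x) {x₀ : Fin n → ℝ} (hx₀ : x₀ ∈ U) :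
    ∃ f : Module.Dual ℝ (Fin n → ℝ), ∀ x ∈ U, T x = f x := by
  let R : (Fin n → ℝ) → (Fin n → ℝ) → Prop := fun x y =>
    ∃ f : Module.Dual ℝ (Fin n → ℝ), (∀ᶠ z in 𝓝[P] x, T z = f z) ∧ ∀ᶠ z in 𝓝[P] y, T z = f z
  have hR : ∀ x ∈ U, R x₀ x := by
    intro x hx
    refine hU.induction₂' R ?_ ?_ hx₀ hx
    · intro y hy
      obtain ⟨f, hf⟩ := hT y hy
      have h1 := eventually_eventually_nhdsWithin.2 hf
      filter_upwards [nhdsWithin_mono y hUP h1] with z hz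
      exact ⟨⟨f, hf, hz⟩, ⟨f, hz, hf⟩⟩
    · rintro a b c ha hb hc ⟨f, hfa, hfb⟩ ⟨g, hgb, hgc⟩
      refine ⟨f, hfa, ?_⟩
      have hfg : ∀ z ∈ P, f z = g z := fun z hz => by
        refine dual_eq_of_eventually (hUP hb) ?_ hz
        filter_upwards [hfb, hgb] with y h1 h2
        rw [← h1, ← h2]
      filter_upwards [hgc, self_mem_nhdsWithin] with y hy hyP
      rw [hy, hfg y hyP]
  obtain ⟨f, hf⟩ := hT x₀ hx₀
  refine ⟨f, fun x hx => ?_⟩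
  obtain ⟨g, hg, hg'⟩ := hR x hx
  rw [hg'.self_of_nhdsWithin (hUP hx)]
  refine dual_eq_of_eventually (hUP hx₀) ?_ (hUP hx)
  filter_upwards [hf, hg] with y h1 h2
  rw [← h1, ← h2]

theorem isPreconnected_plane_diff_zero {n : ℕ} {P : Submodule ℝ (Fin n → ℝ)}
    (hP2 : Module.finrank ℝ P = 2) : IsPreconnected ((P : Set (Fin n → ℝ)) \ {0}) := by
  have h1 : 1 < Module.rank ℝ P := by
    rw [← Module.finrank_eq_rank, hP2]
    exact_mod_cast one_lt_two
  have h2 := (isConnected_compl_singleton_of_one_lt_rank h1 (0 : P)).isPreconnected.image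
    (Subtype.val) continuous_subtype_val.continuousOn
  convert h2 using 1
  ext x
  constructor
  · rintro ⟨hx, hx0⟩
    exact ⟨⟨x, hx⟩, fun h => hx0 (congrArg Subtype.val h), rfl⟩
  · rintro ⟨y, hy, rfl⟩
    exact ⟨y.2, fun h => hy (Subtype.ext h)⟩

theorem TRFunction.exists_int {n : ℕ} (T : TRFunction n) (z : Fin n → ℤ) :
    ∃ k : ℤ, T.toFun (toReal n z) = k := by
  obtain ⟨s, hs, h⟩ := T.exists_max
  obtain ⟨l, -, hl⟩ := Finset.exists_mem_eq_sup' hs (fun l => realForm l (toReal n z))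
  refine ⟨∑ i, l (Pi.single i 1) * z i, ?_⟩
  rw [h, hl]
  simp [realForm, toReal]

/-! ### Constancy of the weights of a fan whose support is a plane -/

namespace TropicalFan

variable {n : ℕ} {F : TropicalFan n 2} {P : Submodule ℝ (Fin n → ℝ)}

/-- Across the common ray, balancing has only two terms, with generators equal up to sign modulo
`⟨τ⟩`. Equal generators would force the sum of two positive weights to vanish; opposite ones force
the weights to agree. -/
theorem weight_eq_of_mem_of_mem (hP : F.support = P) (hP2 : Module.finrank ℝ P = 2)
    {σ₁ σ₂ : PointedCone ℝ (Fin n → ℝ)} (h₁ : σ₁ ∈ F.activeFacets) (h₂ : σ₂ ∈ F.activeFacets)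
    {x : Fin n → ℝ} (hx : x ≠ 0) (hx₁ : x ∈ σ₁) (hx₂ : x ∈ σ₂) : F.weight σ₁ = F.weight σ₂ := by
  by_cases hne : σ₁ = σ₂
  · rw [hne]
  obtain ⟨τ, hτ, hτ1, -, hτ₁, hτ₂⟩ := WeightedFan.exists_ray_of_mem_of_mem
    (WeightedFan.mem_facets.2 (WeightedFan.mem_activeFacets.1 h₁).1)
    (WeightedFan.mem_facets.2 (WeightedFan.mem_activeFacets.1 h₂).1) hne hx hx₁ hx₂
  obtain ⟨v, hv, -⟩ := F.balanced τ hτ (by omega)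
  have hs := F.balanced.sum_mem hτ (by omega) hv
  rw [WeightedFan.sum_star_eq_of_ray hP hP2 hτ1 hτ h₁ h₂ hτ₁ hτ₂ hne _ (fun σ h => by
    rw [h, Nat.cast_zero, zero_smul])] at hs
  have m₁ := WeightedFan.activeFacets_mem_star h₁ hτ₁
  have m₂ := WeightedFan.activeFacets_mem_star h₂ hτ₂
  have hn := hv.notMem_linSpan (by omega) m₁
  have hL : linSpan σ₁ = linSpan σ₂ := by
    rw [WeightedFan.linSpan_activeFacet hP hP2 h₁, WeightedFan.linSpan_activeFacet hP hP2 h₂]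
  rcases (hv σ₁ m₁).congr (hv σ₂ m₂) hL hn with h | h
  · have h3 := add_mem hs (Submodule.smul_mem _ (F.weight σ₂ : ℝ) h)
    have h4 : ((F.weight σ₁ : ℝ) + F.weight σ₂) • toReal n (v σ₁) ∈ linSpan τ := by
      convert h3 using 1
      module
    exfalso
    refine hn ((Submodule.smul_mem_iff _ ?_).1 h4)
    have := Nat.pos_of_ne_zero (WeightedFan.mem_activeFacets.1 h₁).2
    positivity
  · have h3 := sub_mem hs (Submodule.smul_mem _ (F.weight σ₂ : ℝ) h)
    have h4 : ((F.weight σ₁ : ℝ) - F.weight σ₂) • toReal n (v σ₁) ∈ linSpan τ := by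
      convert h3 using 1
      module
    by_contra hne'
    refine hn ((Submodule.smul_mem_iff _ ?_).1 h4)
    rw [sub_ne_zero]
    exact_mod_cast hne'

theorem weight_eq (hP : F.support = P) (hP2 : Module.finrank ℝ P = 2)
    {σ₁ σ₂ : PointedCone ℝ (Fin n → ℝ)} (h₁ : σ₁ ∈ F.activeFacets)
    (h₂ : σ₂ ∈ F.activeFacets) : F.weight σ₁ = F.weight σ₂ := by
  -- Neighbouring facets share a non-zero point, so the comparison is spread along the connected set
  -- `P ∖ {0}`.
  let R : (Fin n → ℝ) → (Fin n → ℝ) → Prop := fun x y =>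
    ∀ σ ∈ F.activeFacets, ∀ σ' ∈ F.activeFacets, x ∈ σ → y ∈ σ' → F.weight σ = F.weight σ'
  have ex : ∀ σ ∈ F.activeFacets, ∃ x ∈ σ, x ≠ 0 := by
    intro σ hσ
    have h := (WeightedFan.mem_activeFacets.1 hσ).1
    obtain ⟨z, hz, hz0⟩ := exists_ne_zero_of_dim_pos (by omega) (F.rational σ h.1)
    exact ⟨_, hz, fun h => hz0 (toReal_injective n (by rw [map_zero]; exact h))⟩
  obtain ⟨x₁, hx₁, hx₁0⟩ := ex σ₁ h₁
  obtain ⟨x₂, hx₂, hx₂0⟩ := ex σ₂ h₂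
  refine (isPreconnected_plane_diff_zero hP2).induction₂' R ?_ ?_
    (x := x₁) (y := x₂) ⟨WeightedFan.mem_plane hP h₁ hx₁, hx₁0⟩
    ⟨WeightedFan.mem_plane hP h₂ hx₂, hx₂0⟩ σ₁ h₁ σ₂ h₂ hx₁ hx₂
  · intro x hx
    filter_upwards [nhdsWithin_le_nhds (F.eventually_mem_imp_mem x)] with y hy
    refine ⟨fun σ hσ σ' hσ' hxσ hyσ' => ?_, fun σ hσ σ' hσ' hyσ hxσ' => ?_⟩
    · exact weight_eq_of_mem_of_mem hP hP2 hσ hσ' hx.2 hxσ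
        (hy σ' (WeightedFan.mem_activeFacets.1 hσ').1.1 hyσ')
    · exact weight_eq_of_mem_of_mem hP hP2 hσ hσ' hx.2
        (hy σ (WeightedFan.mem_activeFacets.1 hσ).1.1 hyσ) hxσ'
  · intro x y z _ hy _ hxy hyz σ hσ σ' hσ' hxσ hzσ'
    obtain ⟨σ'', hσ'', hyσ''⟩ := WeightedFan.exists_activeFacet hP hy.1
    exact (hxy σ hσ σ'' hσ'' hxσ hyσ'').trans (hyz σ'' hσ'' σ' hσ' hyσ'' hzσ')

theorem exists_weight (hP : F.support = P) (hP2 : Module.finrank ℝ P = 2) :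
    ∃ c : ℕ, c ≠ 0 ∧ ∀ σ ∈ F.activeFacets, F.weight σ = c := by
  obtain ⟨σ, hσ, -⟩ := WeightedFan.exists_activeFacet hP (zero_mem P)
  exact ⟨F.weight σ, (WeightedFan.mem_activeFacets.1 hσ).2, fun σ' hσ' => weight_eq hP hP2 hσ' hσ⟩

end TropicalFan

/-! ### Products with fans whose support is a plane -/

theorem dual_eq_of_mem_linSpan {n : ℕ} {τ : PointedCone ℝ (Fin n → ℝ)}
    {f g : Module.Dual ℝ (Fin n → ℝ)} (h : ∀ y ∈ τ, f y = g y) {y : Fin n → ℝ}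
    (hy : y ∈ linSpan τ) : f y = g y := by
  obtain ⟨a, ha, b, hb, rfl⟩ := mem_linSpan_iff.1 hy
  rw [map_sub, map_sub, h a ha, h b hb]

theorem dual_eq_of_le_sup {n : ℕ} {P Q : Submodule ℝ (Fin n → ℝ)} {v : Fin n → ℝ}
    {f g : Module.Dual ℝ (Fin n → ℝ)} (hP : P ≤ Q ⊔ Submodule.span ℝ {v})
    (h : ∀ y ∈ Q, f y = g y) (hv : f v = g v) {y : Fin n → ℝ} (hy : y ∈ P) : f y = g y := by
  obtain ⟨a, ha, b, hb, rfl⟩ := Submodule.mem_sup.1 (hP hy)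
  obtain ⟨c, rfl⟩ := Submodule.mem_span_singleton.1 hb
  rw [map_add, map_add, map_smul, map_smul, h a ha, hv]

namespace IsFanProduct

theorem weight_eq {n k : ℕ} {T : TRFunction n} {F : TropicalFan n (k + 1)}
    {G : TropicalFan n k} (h : IsFanProduct T F G) :
    ∃ T' : PointedCone ℝ (Fin n → ℝ) → Module.Dual ℝ (Fin n → ℝ),
      (∀ σ ∈ F.cones, ∀ x ∈ σ, T.toFun x = T' σ x) ∧
      ∀ τ ∈ F.cones, dim τ = k → ∃ v : PointedCone ℝ (Fin n → ℝ) → (Fin n → ℤ),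
        F.IsNormalChoice τ v ∧
        ∑ σ ∈ F.star τ, (F.weight σ : ℝ) • toReal n (v σ) ∈ linSpan τ ∧
        (G.weight τ : ℝ) = ∑ σ ∈ F.star τ, (F.weight σ : ℝ) * T' σ (toReal n (v σ))
          - T' τ (∑ σ ∈ F.star τ, (F.weight σ : ℝ) • toReal n (v σ)) := by
  obtain ⟨-, T', hT', hw⟩ := h
  refine ⟨T', hT', fun τ hτ hd => ?_⟩
  obtain ⟨v, hv, hwv⟩ := hw τ hτ hd
  refine ⟨v, hv, F.balanced.sum_mem hτ (by omega) hv, ?_⟩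
  rw [hwv, WeightedFan.toReal_sum]
  simp only [toReal_nsmul, map_smul, smul_eq_mul]

variable {n : ℕ} {T : TRFunction n} {F : TropicalFan n 2} {G : TropicalFan n 1}
  {P : Submodule ℝ (Fin n → ℝ)}

/-- If a single form `f` represented `T` near `x`, it would represent every `T_σ` of non-zero weight
as well as `T_τ`, and the two halves of the weight formula would cancel. -/
theorem mem_plane_and_not_locallyLinearAt (h : IsFanProduct T F G) (hP : F.support = P)
    {τ : PointedCone ℝ (Fin n → ℝ)} (hτ : τ ∈ F.cones) (hτ1 : dim τ = 1) (hG : G.weight τ ≠ 0)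
    {x : Fin n → ℝ} (hx : x ∈ τ) (hx0 : x ≠ 0) :
    x ∈ P ∧ ¬ LocallyLinearAt T.toFun P x := by
  obtain ⟨T', hT', hw⟩ := h.weight_eq
  obtain ⟨v, hv, hs, hwv⟩ := hw τ hτ hτ1
  have hxP : x ∈ P := by
    by_contra hxP
    have hz : ∀ σ ∈ F.star τ, F.weight σ = 0 := by
      intro σ hσ
      by_contra hne
      rw [WeightedFan.mem_star, WeightedFan.mem_facets] at hσ
      exact hxP (WeightedFan.mem_plane hP (WeightedFan.mem_activeFacets.2 ⟨hσ.1, hne⟩)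
        (hσ.2.le hx))
    rw [Finset.sum_eq_zero fun σ hσ => by rw [hz σ hσ, Nat.cast_zero, zero_mul],
      Finset.sum_eq_zero fun σ hσ => by rw [hz σ hσ, Nat.cast_zero, zero_smul], map_zero,
      sub_zero] at hwv
    exact hG (by exact_mod_cast hwv)
  refine ⟨hxP, ?_⟩
  rintro ⟨f, hf⟩
  have hfx : T.toFun x = f x := hf.self_of_nhdsWithin hxP
  have key : ∀ σ ∈ F.star τ, F.weight σ ≠ 0 → ∀ y ∈ σ, T' σ y = f y := by
    intro σ hσ hne y hy
    rw [WeightedFan.mem_star, WeightedFan.mem_facets] at hσ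
    have hyP := WeightedFan.mem_plane hP (WeightedFan.mem_activeFacets.2 ⟨hσ.1, hne⟩) hy
    obtain ⟨t, ht, h1⟩ := exists_pos_of_eventually hxP hyP hf
    rw [hT' σ hσ.1.1 _ (add_mem (hσ.2.le hx) (σ.smul_mem ht.le hy)), map_add, map_add,
      ← hT' σ hσ.1.1 x (hσ.2.le hx), hfx, map_smul, map_smul, smul_eq_mul, smul_eq_mul] at h1
    exact mul_left_cancel₀ ht.ne' (add_left_cancel h1)
  have hτf : ∀ y ∈ linSpan τ, T' τ y = f y := by
    intro y hy
    rw [linSpan_eq_span_singleton hτ1 hx hx0, Submodule.mem_span_singleton] at hy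
    obtain ⟨c, rfl⟩ := hy
    rw [map_smul, map_smul, ← hT' τ hτ x hx, hfx]
  refine hG ?_
  have : (G.weight τ : ℝ) = 0 := by
    rw [hwv, hτf _ hs, map_sum, ← Finset.sum_sub_distrib]
    refine Finset.sum_eq_zero fun σ hσ => ?_
    by_cases hne : F.weight σ = 0
    · rw [hne, Nat.cast_zero, zero_mul, zero_smul, map_zero, sub_zero]
    · rw [map_smul, smul_eq_mul, dual_eq_of_mem_linSpan (key σ hσ hne) (hv σ hσ).1, sub_self]
  exact_mod_cast this

/-- If the product has weight zero on a ray through `x`, the two-term formula makes the linear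
pieces on both sides agree at a primitive generator. They also agree on the ray, hence on `P`, so
one form represents `T` near `x`. -/
theorem exists_ray_of_not_locallyLinearAt (h : IsFanProduct T F G) (hP : F.support = P)
    (hP2 : Module.finrank ℝ P = 2) {x : Fin n → ℝ} (hxP : x ∈ P) (hx0 : x ≠ 0)
    (hx : ¬ LocallyLinearAt T.toFun P x) :
    ∃ τ ∈ F.cones, dim τ = 1 ∧ x ∈ τ ∧ G.weight τ ≠ 0 := by
  obtain ⟨T', hT', hw⟩ := h.weight_eq
  by_contra! hc
  obtain ⟨σ₀, hσ₀, hxσ₀⟩ := WeightedFan.exists_activeFacet hP hxP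
  have m₀ := (WeightedFan.mem_activeFacets.1 hσ₀).1
  have key : ∀ σ ∈ F.activeFacets, x ∈ σ → ∀ y ∈ P, T' σ y = T' σ₀ y := by
    intro σ hσ hxσ y hy
    by_cases hne : σ = σ₀
    · rw [hne]
    have m := (WeightedFan.mem_activeFacets.1 hσ).1
    obtain ⟨τ, hτ, hτ1, hxτ, hτσ, hτσ₀⟩ := WeightedFan.exists_ray_of_mem_of_mem
      (WeightedFan.mem_facets.2 m) (WeightedFan.mem_facets.2 m₀) hne hx0 hxσ hxσ₀
    obtain ⟨v, hv, hs, hwv⟩ := hw τ hτ hτ1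
    have sum_eq := fun {M : Type} [AddCommMonoid M] =>
      WeightedFan.sum_star_eq_of_ray hP hP2 hτ1 hτ hσ hσ₀ hτσ hτσ₀ hne (M := M)
    have e₀ : ∀ z ∈ linSpan τ, T' τ z = T' σ₀ z := fun z hz =>
      dual_eq_of_mem_linSpan (fun y hy => by
        rw [← hT' τ hτ y hy, ← hT' σ₀ m₀.1 y (hτσ₀.le hy)]) hz
    have e₁ : ∀ z ∈ linSpan τ, T' σ z = T' σ₀ z := fun z hz =>
      dual_eq_of_mem_linSpan (fun y hy => by
        rw [← hT' σ m.1 y (hτσ.le hy), ← hT' σ₀ m₀.1 y (hτσ₀.le hy)]) hz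
    rw [hc τ hτ hτ1 hxτ, Nat.cast_zero, e₀ _ hs,
      sum_eq _ (fun σ h => by rw [h, Nat.cast_zero, zero_mul]),
      sum_eq _ (fun σ h => by rw [h, Nat.cast_zero, zero_smul]), map_add, map_smul, map_smul,
      smul_eq_mul, smul_eq_mul] at hwv
    refine dual_eq_of_le_sup (WeightedFan.le_linSpan_sup hP hP2 hσ
      (hv σ (WeightedFan.activeFacets_mem_star hσ hτσ))) e₁ ?_ hy
    have hne0 : (F.weight σ : ℝ) ≠ 0 := by
      exact_mod_cast (WeightedFan.mem_activeFacets.1 hσ).2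
    refine mul_left_cancel₀ hne0 ?_
    linarith
  refine hx ⟨T' σ₀, ?_⟩
  filter_upwards [self_mem_nhdsWithin, nhdsWithin_le_nhds (F.eventually_mem_imp_mem x)]
    with y hyP hy
  obtain ⟨σ, hσ, hyσ⟩ := WeightedFan.exists_activeFacet hP hyP
  have m := (WeightedFan.mem_activeFacets.1 hσ).1
  rw [hT' σ m.1 y hyσ, key σ hσ (hy σ m.1 hyσ) y hyP]

/-- The form `f` is known only through `T` on `σ`. Adding a large multiple of a lattice vector of
the ray moves `z` into `σ`, where `f` equals the integer-valued `T`. -/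
theorem exists_int_of_add_mem {τ σ : PointedCone ℝ (Fin n → ℝ)} {f : Module.Dual ℝ (Fin n → ℝ)}
    (hf : ∀ y ∈ σ, T.toFun y = f y) (hτσ : τ ≤ σ) (hτ1 : dim τ = 1) (hτ : IsRationalCone τ)
    {z : Fin n → ℤ} {t : Fin n → ℝ} (ht : t ∈ linSpan τ) (hz : toReal n z + t ∈ σ) :
    ∃ k : ℤ, f (toReal n z) = k := by
  obtain ⟨s, hs, hs0⟩ := exists_ne_zero_of_dim_pos (by omega) hτ
  have hs0' : toReal n s ≠ 0 := fun h => hs0 (toReal_injective n (by rw [map_zero]; exact h))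
  rw [linSpan_eq_span_singleton hτ1 hs hs0', Submodule.mem_span_singleton] at ht
  obtain ⟨c, rfl⟩ := ht
  obtain ⟨N, hN⟩ := exists_nat_ge c
  have h1 : toReal n (z + N • s) ∈ σ := by
    have : toReal n (z + N • s) = toReal n z + c • toReal n s + (N - c) • toReal n s := by
      rw [map_add, toReal_nsmul]
      module
    rw [this]
    exact add_mem hz (σ.smul_mem (by linarith) (hτσ hs))
  obtain ⟨a, ha⟩ := T.exists_int (z + N • s)
  obtain ⟨b, hb⟩ := T.exists_int s
  rw [hf _ h1, map_add, map_add, toReal_nsmul, map_smul, ← hf _ (hτσ hs), hb, smul_eq_mul] at ha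
  refine ⟨a - N * b, ?_⟩
  push_cast
  linarith

/-- The common weight `c` factors out of the product formula, and the remaining values of `T_σ` and
`T_τ` at lattice vectors are integers. -/
theorem dvd_weight (h : IsFanProduct T F G) {c : ℕ}
    (hc0 : c ≠ 0) (hc : ∀ σ ∈ F.activeFacets, F.weight σ = c) {τ : PointedCone ℝ (Fin n → ℝ)}
    (hτ : τ ∈ F.cones) (hτ1 : dim τ = 1) : c ∣ G.weight τ := by
  classical
  obtain ⟨T', hT', hw⟩ := h.weight_eq
  obtain ⟨v, hv, hs, hwv⟩ := hw τ hτ hτ1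
  set A := (F.star τ).filter (fun σ => F.weight σ ≠ 0) with hA
  have hAw : ∀ σ ∈ A, F.weight σ = c := by
    intro σ hσ
    rw [hA, Finset.mem_filter, WeightedFan.mem_star, WeightedFan.mem_facets] at hσ
    exact hc σ (WeightedFan.mem_activeFacets.2 ⟨hσ.1.1, hσ.2⟩)
  have hAstar : ∀ σ ∈ A, σ ∈ F.star τ := fun σ hσ => (Finset.mem_filter.1 hσ).1
  have s1 : ∑ σ ∈ F.star τ, (F.weight σ : ℝ) • toReal n (v σ) =
      (c : ℝ) • toReal n (∑ σ ∈ A, v σ) := by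
    rw [map_sum, Finset.smul_sum, ← Finset.sum_filter_of_ne (p := fun σ => F.weight σ ≠ 0)]
    · exact Finset.sum_congr rfl fun σ hσ => by rw [hAw σ hσ]
    · intro σ _ hne hz
      exact hne (by rw [hz, Nat.cast_zero, zero_smul])
  have s2 : ∑ σ ∈ F.star τ, (F.weight σ : ℝ) * T' σ (toReal n (v σ)) =
      (c : ℝ) * ∑ σ ∈ A, T' σ (toReal n (v σ)) := by
    rw [Finset.mul_sum, ← Finset.sum_filter_of_ne (p := fun σ => F.weight σ ≠ 0)]
    · exact Finset.sum_congr rfl fun σ hσ => by rw [hAw σ hσ]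
    · intro σ _ hne hz
      exact hne (by rw [hz, Nat.cast_zero, zero_mul])
  have hc0' : (c : ℝ) ≠ 0 := by exact_mod_cast hc0
  have i1 : ∀ σ ∈ A, ∃ k : ℤ, T' σ (toReal n (v σ)) = k := by
    intro σ hσ
    have hσ' := WeightedFan.mem_star.1 (hAstar σ hσ)
    obtain ⟨t, ht, hvt⟩ := (hv σ (hAstar σ hσ)).2.2
    exact exists_int_of_add_mem (hT' σ (WeightedFan.mem_facets.1 hσ'.1).1) hσ'.2.le hτ1
      (F.rational τ hτ) ht hvt
  have i2 : ∃ k : ℤ, T' τ (toReal n (∑ σ ∈ A, v σ)) = k := by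
    rw [s1, Submodule.smul_mem_iff _ hc0'] at hs
    -- The ray is used as its own ambient cone: the sum lies in `⟨τ⟩`, so its negative translates it
    -- to `0 ∈ τ`.
    refine exists_int_of_add_mem (hT' τ hτ) le_rfl hτ1 (F.rational τ hτ) (neg_mem hs) ?_
    rw [add_neg_cancel]
    exact zero_mem τ
  choose! k hk using i1
  obtain ⟨l, hl⟩ := i2
  rw [s1, s2, map_smul, smul_eq_mul, hl, Finset.sum_congr rfl hk] at hwv
  have : (G.weight τ : ℤ) = c * (∑ σ ∈ A, k σ - l) := by
    have h3 : ((G.weight τ : ℤ) : ℝ) = ((c * (∑ σ ∈ A, k σ - l) : ℤ) : ℝ) := by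
      push_cast
      rw [hwv]
      ring
    exact_mod_cast h3
  exact Int.natCast_dvd_natCast.1 ⟨_, this⟩

end IsFanProduct

/-! ### One-dimensional cycles -/

namespace WeightedFan

/-- The weight of the facets, extended by zero to all other cones. -/
noncomputable def facetWeight {n k : ℕ} (F : WeightedFan n k) (σ : PointedCone ℝ (Fin n → ℝ)) : ℕ :=
  open Classical in if σ ∈ F.activeFacets then F.weight σ else 0

theorem eq_of_le_of_dim_eq_one {n : ℕ} {σ τ : PointedCone ℝ (Fin n → ℝ)} (h : σ ≤ τ)
    (hσ : dim σ = 1) (hτ : dim τ = 1) (hσr : IsRationalCone σ) (hτs : IsStronglyConvex τ) :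
    σ = τ := by
  obtain ⟨z, hz, hz0⟩ := exists_ne_zero_of_dim_pos (by omega) hσr
  have hz0' : toReal n z ≠ 0 := fun h => hz0 (toReal_injective n (by rw [map_zero]; exact h))
  refine le_antisymm h fun x hx => ?_
  obtain ⟨c, hc, rfl⟩ := (mem_ray_iff hτ hτs (h hz) hz0').1 hx
  exact σ.smul_mem hc hz

/-- Rays cannot be subdivided, so refinement preserves the weighted rays themselves. This makes
`Cycle.rayWeight` well defined. -/
theorem Refines.facetWeight_eq {n : ℕ} {X Y : WeightedFan n 1} (h : X.Refines Y) :
    X.facetWeight = Y.facetWeight := by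
  have key : ∀ σ ∈ X.activeFacets, σ ∈ Y.activeFacets ∧ Y.weight σ = X.weight σ := by
    intro σ hσ
    have m := mem_activeFacets.1 hσ
    obtain ⟨σ', hσ', hle, hw⟩ := h.2 σ (mem_facets.2 m.1) m.2
    have m' := mem_facets.1 hσ'
    have := eq_of_le_of_dim_eq_one hle m.1.2 m'.2 (X.rational σ m.1.1) (Y.stronglyConvex σ' m'.1)
    subst this
    exact ⟨mem_activeFacets.2 ⟨m', by rw [hw]; exact m.2⟩, hw⟩
  have key' : ∀ σ ∈ Y.activeFacets, σ ∈ X.activeFacets := by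
    intro σ hσ
    have m := mem_activeFacets.1 hσ
    obtain ⟨z, hz, hz0⟩ := exists_ne_zero_of_dim_pos (by omega) (Y.rational σ m.1.1)
    have hz0' : toReal n z ≠ 0 := fun h => hz0 (toReal_injective n (by rw [map_zero]; exact h))
    have hs : toReal n z ∈ X.support := by
      rw [h.1]; exact mem_support_iff.2 ⟨σ, hσ, hz⟩
    obtain ⟨ρ, hρ, hzρ⟩ := mem_support_iff.1 hs
    have mX := mem_activeFacets.1 hρ
    have mY := mem_activeFacets.1 (key ρ hρ).1
    have : ρ = σ := by
      ext x
      rw [mem_ray_iff mX.1.2 (X.stronglyConvex ρ mX.1.1) hzρ hz0',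
        mem_ray_iff m.1.2 (Y.stronglyConvex σ m.1.1) hz hz0']
    rwa [← this]
  funext σ
  unfold facetWeight
  by_cases hσ : σ ∈ X.activeFacets
  · rw [if_pos hσ, if_pos (key σ hσ).1, (key σ hσ).2]
  · rw [if_neg hσ, if_neg fun h' => hσ (key' σ h')]

theorem facetWeight_of_mem {n k : ℕ} {F : WeightedFan n k} {σ : PointedCone ℝ (Fin n → ℝ)}
    (hσ : σ ∈ F.facets) : F.facetWeight σ = F.weight σ := by
  unfold facetWeight
  split_ifs with h
  · rfl
  · by_contra hne
    exact h (mem_activeFacets.2 ⟨mem_facets.1 hσ, fun h' => hne h'.symm⟩)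

theorem mem_activeFacets_iff_facetWeight {n k : ℕ} {F : WeightedFan n k}
    {σ : PointedCone ℝ (Fin n → ℝ)} : σ ∈ F.activeFacets ↔ F.facetWeight σ ≠ 0 := by
  unfold facetWeight
  split_ifs with h
  · exact ⟨fun _ => (mem_activeFacets.1 h).2, fun _ => h⟩
  · exact ⟨fun h' => absurd h' h, fun h' => absurd rfl h'⟩

end WeightedFan

/-- The weights of the rays of a one-dimensional cycle. -/
noncomputable def Cycle.rayWeight {n : ℕ} : Cycle n 1 → PointedCone ℝ (Fin n → ℝ) → ℕ :=
  Quot.lift (fun F => F.toWeightedFan.facetWeight) (by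
    rintro F G ⟨X, hF, hG⟩
    exact hF.facetWeight_eq.symm.trans hG.facetWeight_eq)

theorem linSpan_bot {n : ℕ} : linSpan (⊥ : PointedCone ℝ (Fin n → ℝ)) = ⊥ :=
  Submodule.span_eq_bot.2 fun _ hx => hx

/-- The degree of the product of a one-dimensional cycle with a tropical regular function. -/
theorem IsProduct.degree {n : ℕ} {S : TRFunction n} {D : Cycle n 1} {E : Cycle n 0}
    (h : IsProduct S D E) :
    ∃ (A : Finset (PointedCone ℝ (Fin n → ℝ))) (u : PointedCone ℝ (Fin n → ℝ) → (Fin n → ℤ)),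
      (∀ τ, τ ∈ A ↔ D.rayWeight τ ≠ 0) ∧
      (∀ τ ∈ A, toReal n (u τ) ∈ τ ∧ toReal n (u τ) ≠ 0) ∧
      ∑ τ ∈ A, (D.rayWeight τ : ℝ) • toReal n (u τ) = 0 ∧
      ∑ τ ∈ A, (D.rayWeight τ : ℝ) * S.toFun (toReal n (u τ)) = E.degree := by
  obtain ⟨F, G, rfl, rfl, h⟩ := h
  obtain ⟨T', hT', hw⟩ := h.weight_eq
  -- At the zero cone `⟨τ⟩ = 0`: primitive generators lie on their rays, and balancing becomes an
  -- honest equation.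
  obtain ⟨v, hv, hs, hwv⟩ := hw ⊥ F.bot_mem dim_bot
  rw [linSpan_bot, Submodule.mem_bot] at hs
  have hstar : F.star ⊥ = F.facets := by
    ext σ
    rw [WeightedFan.mem_star, and_iff_left_iff_imp]
    intro hσ
    rw [bot_lt_iff_ne_bot]
    rintro rfl
    have := (WeightedFan.mem_facets.1 hσ).2
    rw [dim_bot] at this
    omega
  have hr : ∀ τ, F.cycle.rayWeight τ = F.facetWeight τ := fun _ => rfl
  have hd : G.cycle.degree = G.weight ⊥ := rfl
  have hv' : ∀ σ ∈ F.facets, toReal n (v σ) ∈ σ ∧ toReal n (v σ) ≠ 0 := by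
    intro σ hσ
    rw [← hstar] at hσ
    constructor
    · obtain ⟨t, ht, h⟩ := (hv σ hσ).2.2
      rw [linSpan_bot, Submodule.mem_bot] at ht
      rwa [ht, add_zero] at h
    · intro h0
      refine hv.notMem_linSpan (by rw [dim_bot]) hσ ?_
      rw [h0]
      exact zero_mem _
  have hsub : F.activeFacets ⊆ F.facets := Finset.filter_subset _ _
  refine ⟨F.activeFacets, v, fun τ => WeightedFan.mem_activeFacets_iff_facetWeight,
    fun τ hτ => hv' τ (hsub hτ), ?_, ?_⟩
  · rw [Finset.sum_subset hsub, ← hs, hstar]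
    · exact Finset.sum_congr rfl fun τ hτ => by rw [hr, WeightedFan.facetWeight_of_mem hτ]
    · intro τ _ hτ
      rw [WeightedFan.mem_activeFacets_iff_facetWeight, not_not] at hτ
      rw [hr, hτ, Nat.cast_zero, zero_smul]
  · rw [Finset.sum_subset hsub, hd, hwv, hs, map_zero, sub_zero, hstar]
    · refine Finset.sum_congr rfl fun τ hτ => ?_
      rw [hr, WeightedFan.facetWeight_of_mem hτ,
        hT' τ (WeightedFan.mem_facets.1 hτ).1 _ (hv' τ hτ).1]
    · intro τ _ hτ
      rw [WeightedFan.mem_activeFacets_iff_facetWeight, not_not] at hτ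
      rw [hr, hτ, Nat.cast_zero, zero_mul]

/-- An intersection number on a cycle whose support is the plane `P`, as a sum over the corner
locus of `T` on `P`. -/
theorem HasIntersectionNumber.exists_rays {n : ℕ} {S T : TRFunction n} {L : Cycle n 2} {d : ℕ}
    (h : HasIntersectionNumber S T L d) {P : Submodule ℝ (Fin n → ℝ)} (hP : L.support = P)
    (hP2 : Module.finrank ℝ P = 2) :
    ∃ (A : Finset (PointedCone ℝ (Fin n → ℝ))) (ω : PointedCone ℝ (Fin n → ℝ) → ℕ)
      (u : PointedCone ℝ (Fin n → ℝ) → (Fin n → ℤ)) (c : ℕ) (F : TropicalFan n 2),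
      (∀ τ ∈ A, ω τ ≠ 0) ∧
      ∑ τ ∈ A, (ω τ : ℝ) • toReal n (u τ) = 0 ∧
      ∑ τ ∈ A, (ω τ : ℝ) * S.toFun (toReal n (u τ)) = d ∧
      (∀ τ ∈ A, toReal n (u τ) ∈ P ∧ toReal n (u τ) ≠ 0 ∧
        ¬ LocallyLinearAt T.toFun P (toReal n (u τ))) ∧
      (∀ x ∈ P, x ≠ 0 → ¬ LocallyLinearAt T.toFun P x →
        ∃ τ ∈ A, ∃ r : ℝ, 0 < r ∧ x = r • toReal n (u τ)) ∧
      F.cycle = L ∧ c ≠ 0 ∧ (∀ σ ∈ F.activeFacets, F.weight σ = c) ∧ ∀ τ ∈ A, c ∣ ω τ := by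
  obtain ⟨D, E, ⟨F, G, hF, hG, hFG⟩, hSE, hE⟩ := h
  obtain ⟨A, u, hA, hu, h0, hd⟩ := hSE.degree
  have hFP : F.support = P := by rw [← hP, ← hF]; rfl
  -- The outer product may use a representative of `D` other than `G`; the invariant ray weights
  -- link the two.
  have hDG : ∀ τ, D.rayWeight τ = G.facetWeight τ := by intro τ; rw [← hG]; rfl
  have hGm : ∀ τ, τ ∈ G.facets ↔ τ ∈ F.cones ∧ dim τ = 1 := by
    intro τ
    rw [WeightedFan.mem_facets, hFG.1]
    constructor
    · rintro ⟨⟨h1, -⟩, h2⟩; exact ⟨h1, h2⟩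
    · rintro ⟨h1, h2⟩; exact ⟨⟨h1, h2.le⟩, h2⟩
  have hAG : ∀ τ, τ ∈ A ↔ (τ ∈ F.cones ∧ dim τ = 1) ∧ G.weight τ ≠ 0 := by
    intro τ
    rw [hA, hDG, ← WeightedFan.mem_activeFacets_iff_facetWeight, WeightedFan.mem_activeFacets,
      ← WeightedFan.mem_facets, hGm]
  have hω : ∀ τ ∈ A, D.rayWeight τ = G.weight τ := by
    intro τ hτ
    rw [hDG]
    exact WeightedFan.facetWeight_of_mem ((hGm τ).2 ((hAG τ).1 hτ).1)
  obtain ⟨c, hc0, hc⟩ := TropicalFan.exists_weight hFP hP2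
  refine ⟨A, D.rayWeight, u, c, F, fun τ hτ => (hA τ).1 hτ, h0, by rw [hd, hE], fun τ hτ => ?_,
    fun x hxP hx0 hx => ?_, hF, hc0, hc, fun τ hτ => ?_⟩
  · obtain ⟨⟨h1, h2⟩, h3⟩ := (hAG τ).1 hτ
    obtain ⟨h4, h5⟩ := hFG.mem_plane_and_not_locallyLinearAt hFP h1 h2 h3 (hu τ hτ).1 (hu τ hτ).2
    exact ⟨h4, (hu τ hτ).2, h5⟩
  · obtain ⟨τ, hτ, hτ1, hxτ, hw⟩ := hFG.exists_ray_of_not_locallyLinearAt hFP hP2 hxP hx0 hx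
    have hτA := (hAG τ).2 ⟨⟨hτ, hτ1⟩, hw⟩
    obtain ⟨r, hr, rfl⟩ := (mem_ray_iff hτ1 (F.stronglyConvex τ hτ) (hu τ hτA).1
      (hu τ hτA).2).1 hxτ
    refine ⟨τ, hτA, r, lt_of_le_of_ne hr ?_, rfl⟩
    rintro rfl
    exact hx0 (zero_smul _ _)
  · rw [hω τ hτ]
    have h1 := (hAG τ).1 hτ
    exact hFG.dvd_weight hc0 hc h1.1.1 h1.1.2

/-! ### Rational half-spaces -/

/-- A real linear form with integral values on the lattice. -/
def IsIntegralForm {n : ℕ} (l : Module.Dual ℝ (Fin n → ℝ)) : Prop :=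
  ∀ z : Fin n → ℤ, ∃ k : ℤ, l (toReal n z) = k

theorem IsIntegralForm.neg {n : ℕ} {l : Module.Dual ℝ (Fin n → ℝ)} (h : IsIntegralForm l) :
    IsIntegralForm (-l) := fun z => by
  obtain ⟨k, hk⟩ := h z
  exact ⟨-k, by rw [LinearMap.neg_apply, hk, Int.cast_neg]⟩

/-- The closed half-space where a linear form is non-negative. -/
def halfSpace {n : ℕ} (l : Module.Dual ℝ (Fin n → ℝ)) : PointedCone ℝ (Fin n → ℝ) :=
  (PointedCone.positive ℝ ℝ).comap l

theorem mem_halfSpace {n : ℕ} {l : Module.Dual ℝ (Fin n → ℝ)} {x : Fin n → ℝ} :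
    x ∈ halfSpace l ↔ 0 ≤ l x := Iff.rfl

/-- One step of Fourier–Motzkin elimination. -/
theorem IsRationalCone.inf_halfSpace {n : ℕ} {σ : PointedCone ℝ (Fin n → ℝ)}
    (hσ : IsRationalCone σ) {l : Module.Dual ℝ (Fin n → ℝ)} (hl : IsIntegralForm l) :
    IsRationalCone (σ ⊓ halfSpace l) := by
  classical
  obtain ⟨S, rfl⟩ := hσ
  choose a ha using hl
  -- For generators on opposite sides of the hyperplane, this is the positive combination on which
  -- `l` vanishes.
  set w : (Fin n → ℤ) × (Fin n → ℤ) → (Fin n → ℤ) := fun p => a p.1 • p.2 - a p.2 • p.1 with hw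
  set S₀ := S.filter fun s => 0 ≤ a s with hS₀
  set Sp := S.filter fun s => 0 < a s with hSp
  set Sn := S.filter fun s => ¬ 0 ≤ a s with hSn
  set S' := S₀ ∪ (Sp ×ˢ Sn).image w with hS'
  have hwr : ∀ p, toReal n (w p) =
      (a p.1 : ℝ) • toReal n p.2 - (a p.2 : ℝ) • toReal n p.1 := by
    intro p
    rw [hw, map_sub, toReal_zsmul, toReal_zsmul]
  refine ⟨S', le_antisymm ?_ ?_⟩
  · rintro x ⟨hx, hxl⟩
    rw [SetLike.mem_coe, mem_halfSpace] at hxl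
    obtain ⟨c, hc, rfl⟩ := mem_hull_iff.1 hx
    set C := PointedCone.hull ℝ (toReal n '' (S' : Set (Fin n → ℤ)))
    have m₀ : ∀ s ∈ S₀, toReal n s ∈ C := fun s hs =>
      toReal_mem_hull (Finset.mem_union_left _ hs)
    have mp : ∀ s ∈ Sp, toReal n s ∈ C := by
      intro s hs
      refine m₀ s ?_
      rw [hSp, Finset.mem_filter] at hs
      rw [hS₀, Finset.mem_filter]
      exact ⟨hs.1, hs.2.le⟩
    set p := ∑ s ∈ Sp, c s * a s with hp
    set q := ∑ t ∈ Sn, c t * (-a t) with hq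
    have hp0 : 0 ≤ p := Finset.sum_nonneg fun s hs => by
      rw [hSp, Finset.mem_filter] at hs
      exact mul_nonneg (hc s) (by exact_mod_cast hs.2.le)
    have hq_nonneg : ∀ t ∈ Sn, 0 ≤ c t * (-a t : ℝ) := fun t ht => by
      rw [hSn, Finset.mem_filter, not_le] at ht
      refine mul_nonneg (hc t) ?_
      have : (a t : ℝ) < 0 := by exact_mod_cast ht.2
      linarith
    have hsplit : ∀ {M : Type} [AddCommMonoid M] (f : (Fin n → ℤ) → M),
        ∑ s ∈ S, f s = ∑ s ∈ S₀, f s + ∑ s ∈ Sn, f s := fun f =>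
      (Finset.sum_filter_add_sum_filter_not S (fun s => 0 ≤ a s) f).symm
    have hsplit₀ : ∀ {M : Type} [AddCommMonoid M] (f : (Fin n → ℤ) → M),
        ∑ s ∈ S₀, f s = ∑ s ∈ Sp, f s + ∑ s ∈ S₀.filter (fun s => ¬ 0 < a s), f s := by
      intro M _ f
      rw [← Finset.sum_filter_add_sum_filter_not S₀ (fun s => 0 < a s) f]
      congr 2
      ext s
      simp only [hS₀, hSp, Finset.mem_filter]
      constructor
      · rintro ⟨⟨h1, -⟩, h2⟩; exact ⟨h1, h2⟩
      · rintro ⟨h1, h2⟩; exact ⟨⟨h1, h2.le⟩, h2⟩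
    have hpq : q ≤ p := by
      have e : l (∑ s ∈ S, c s • toReal n s) = p - q := by
        rw [map_sum, hsplit, hsplit₀, Finset.sum_eq_zero (s := S₀.filter _), add_zero, hp, hq,
          sub_eq_add_neg, ← Finset.sum_neg_distrib]
        · congr 1
          · exact Finset.sum_congr rfl fun s _ => by rw [map_smul, ha, smul_eq_mul]
          · exact Finset.sum_congr rfl fun s _ => by rw [map_smul, ha, smul_eq_mul]; ring
        · intro s hs
          simp only [hS₀, Finset.mem_filter, not_lt] at hs
          rw [map_smul, ha, le_antisymm hs.2 hs.1.2, Int.cast_zero, smul_zero]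
      linarith
    have hz : p • (∑ t ∈ Sn, c t • toReal n t) + q • (∑ s ∈ Sp, c s • toReal n s) ∈ C := by
      have : p • (∑ t ∈ Sn, c t • toReal n t) + q • (∑ s ∈ Sp, c s • toReal n s) =
          ∑ s ∈ Sp, ∑ t ∈ Sn, (c s * c t) • toReal n (w (s, t)) := by
        rw [hp, Finset.sum_smul, Finset.smul_sum, ← Finset.sum_add_distrib]
        refine Finset.sum_congr rfl fun s _ => ?_
        rw [hq, Finset.smul_sum, Finset.sum_smul, ← Finset.sum_add_distrib]
        refine Finset.sum_congr rfl fun t _ => ?_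
        rw [hwr]
        module
      rw [this]
      refine sum_mem fun s hs => sum_mem fun t ht => C.smul_mem (mul_nonneg (hc s) (hc t)) ?_
      exact toReal_mem_hull (Finset.mem_union_right _ (Finset.mem_image_of_mem w
        (Finset.mem_product.2 ⟨hs, ht⟩)))
    rw [hsplit]
    rcases hp0.eq_or_lt with hp0 | hp0
    · have hq0 : q = 0 := le_antisymm (by linarith) (Finset.sum_nonneg hq_nonneg)
      rw [hq, Finset.sum_eq_zero_iff_of_nonneg hq_nonneg] at hq0
      rw [Finset.sum_eq_zero (s := Sn), add_zero]
      · exact sum_mem fun s hs => C.smul_mem (hc s) (m₀ s hs)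
      · intro t ht
        have h1 := hq0 t ht
        rw [hSn, Finset.mem_filter, not_le] at ht
        have h2 : (-a t : ℝ) ≠ 0 := by
          have : (a t : ℝ) < 0 := by exact_mod_cast ht.2
          linarith
        rw [(mul_eq_zero.1 h1).resolve_right h2, zero_smul]
    · rw [hsplit₀]
      -- The negative part is absorbed by the fraction `q/p` of the positive part. The rest has
      -- coefficient `1 - q/p ≥ 0`, because `l` takes the value `p - q ≥ 0`.
      have e : ∑ s ∈ Sp, c s • toReal n s + ∑ s ∈ S₀.filter (fun s => ¬ 0 < a s), c s • toReal n s
          + ∑ t ∈ Sn, c t • toReal n t = ∑ s ∈ S₀.filter (fun s => ¬ 0 < a s), c s • toReal n s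
          + (1 - p⁻¹ * q) • ∑ s ∈ Sp, c s • toReal n s
          + p⁻¹ • (p • (∑ t ∈ Sn, c t • toReal n t) + q • (∑ s ∈ Sp, c s • toReal n s)) := by
        rw [smul_add, smul_smul p⁻¹ p, inv_mul_cancel₀ hp0.ne']
        module
      rw [e]
      refine add_mem (add_mem ?_ ?_) (C.smul_mem (inv_nonneg.2 hp0.le) hz)
      · exact sum_mem fun s hs => C.smul_mem (hc s) (m₀ s (Finset.mem_of_mem_filter s hs))
      · refine C.smul_mem ?_ (sum_mem fun s hs => C.smul_mem (hc s) (mp s hs))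
        rw [sub_nonneg, inv_mul_le_iff₀ hp0, mul_one]
        exact hpq
  · refine Submodule.span_le.2 ?_
    rintro _ ⟨s, hs, rfl⟩
    rcases Finset.mem_union.1 (Finset.mem_coe.1 hs) with hs | hs
    · rw [hS₀, Finset.mem_filter] at hs
      exact ⟨toReal_mem_hull hs.1, mem_halfSpace.2 (by rw [ha]; exact_mod_cast hs.2)⟩
    · obtain ⟨⟨s, t⟩, hst, rfl⟩ := Finset.mem_image.1 hs
      simp only [hSp, hSn, Finset.mem_product, Finset.mem_filter, not_le] at hst
      obtain ⟨⟨hs, hs'⟩, ⟨ht, ht'⟩⟩ := hst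
      have h1 : (0 : ℝ) < a s := by exact_mod_cast hs'
      have h2 : (a t : ℝ) < 0 := by exact_mod_cast ht'
      refine ⟨?_, mem_halfSpace.2 ?_⟩
      · rw [hwr, sub_eq_add_neg, ← neg_smul]
        exact add_mem (PointedCone.smul_mem _ h1.le (toReal_mem_hull ht))
          (PointedCone.smul_mem _ (by simpa using h2.le) (toReal_mem_hull hs))
      · rw [hwr, map_sub, map_smul, map_smul, ha, ha, smul_eq_mul, smul_eq_mul]
        linarith [mul_comm (a s : ℝ) (a t : ℝ)]

theorem isRationalCone_linSpan {n : ℕ} {σ : PointedCone ℝ (Fin n → ℝ)} (hσ : IsRationalCone σ) :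
    IsRationalCone (linSpan σ : PointedCone ℝ (Fin n → ℝ)) := by
  classical
  obtain ⟨S, hS⟩ := hσ
  refine ⟨S ∪ S.image (fun s => -s), le_antisymm ?_ ?_⟩
  · intro x hx
    obtain ⟨a, ha, b, hb, rfl⟩ := mem_linSpan_iff.1 (PointedCone.mem_ofSubmodule_iff.1 hx)
    rw [sub_eq_add_neg]
    refine add_mem ?_ ?_
    · rw [hS] at ha
      exact Submodule.span_mono (Set.image_mono (by simp)) ha
    · rw [hS, mem_hull_iff] at hb
      obtain ⟨c, hc, rfl⟩ := hb
      rw [← Finset.sum_neg_distrib]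
      refine sum_mem fun s hs => ?_
      rw [← smul_neg, ← map_neg]
      exact PointedCone.smul_mem _ (hc s) (toReal_mem_hull
        (Finset.mem_union_right _ (Finset.mem_image_of_mem _ hs)))
  · refine Submodule.span_le.2 ?_
    rintro _ ⟨s, hs, rfl⟩
    have h : ∀ s ∈ S, toReal n s ∈ linSpan σ := fun s hs =>
      mem_linSpan (by rw [hS]; exact toReal_mem_hull hs)
    rcases Finset.mem_union.1 (Finset.mem_coe.1 hs) with hs | hs
    · exact h s hs
    · obtain ⟨t, ht, rfl⟩ := Finset.mem_image.1 hs
      change toReal n (-t) ∈ linSpan σ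
      rw [map_neg]
      exact neg_mem (h t ht)

/-! ### The fan of an arrangement of hyperplanes -/

/-- The points of `P` where all forms of `I` are non-negative. -/
def chamber {n : ℕ} (P : Submodule ℝ (Fin n → ℝ)) (I : Finset (Module.Dual ℝ (Fin n → ℝ))) :
    PointedCone ℝ (Fin n → ℝ) :=
  (P : PointedCone ℝ (Fin n → ℝ)) ⊓ ⨅ l ∈ I, halfSpace l

theorem mem_chamber {n : ℕ} {P : Submodule ℝ (Fin n → ℝ)}
    {I : Finset (Module.Dual ℝ (Fin n → ℝ))} {x : Fin n → ℝ} :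
    x ∈ chamber P I ↔ x ∈ P ∧ ∀ l ∈ I, 0 ≤ l x := by
  simp [chamber, mem_halfSpace]

theorem isRationalCone_chamber {n : ℕ} {P : Submodule ℝ (Fin n → ℝ)}
    (hP : IsRationalCone (P : PointedCone ℝ (Fin n → ℝ)))
    {I : Finset (Module.Dual ℝ (Fin n → ℝ))} (hI : ∀ l ∈ I, IsIntegralForm l) :
    IsRationalCone (chamber P I) := by
  classical
  induction I using Finset.induction_on with
  | empty => simpa [chamber] using hP
  | insert l I _ ih =>
    have : chamber P (insert l I) = chamber P I ⊓ halfSpace l := by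
      ext x
      simp only [mem_chamber, Finset.mem_insert, Submodule.mem_inf, mem_halfSpace,
        forall_eq_or_imp]
      tauto
    rw [this]
    exact (ih fun l hl => hI l (Finset.mem_insert_of_mem hl)).inf_halfSpace
      (hI l (Finset.mem_insert_self _ _))

/-- A relative interior point for the forms of `I`: sum one witness per form; non-negativity rules
out cancellation. -/
theorem exists_relint {n : ℕ} (g : PointedCone ℝ (Fin n → ℝ))
    (I : Finset (Module.Dual ℝ (Fin n → ℝ))) (h : ∀ l ∈ I, ∀ y ∈ g, 0 ≤ l y) :
    ∃ x ∈ g, ∀ l ∈ I, l x = 0 → ∀ y ∈ g, l y = 0 := by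
  have key : ∀ l : Module.Dual ℝ (Fin n → ℝ), ∃ x ∈ g, l x = 0 → ∀ y ∈ g, l y = 0 := by
    intro l
    by_cases hl : ∀ y ∈ g, l y = 0
    · exact ⟨0, zero_mem g, fun _ => hl⟩
    · push Not at hl
      obtain ⟨x, hx, hlx⟩ := hl
      exact ⟨x, hx, fun h => absurd h hlx⟩
  choose x hx hx0 using key
  refine ⟨∑ l ∈ I, x l, sum_mem fun l _ => hx l, fun l hl h0 => hx0 l ?_⟩
  rw [map_sum, Finset.sum_eq_zero_iff_of_nonneg fun l' _ => h l hl _ (hx l')] at h0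
  exact h0 l hl

theorem exists_large {n : ℕ} (I : Finset (Module.Dual ℝ (Fin n → ℝ))) (x y : Fin n → ℝ) :
    ∃ N : ℝ, 0 < N ∧ ∀ l ∈ I, 0 < l x → 0 < l (N • x + y) := by
  have h : ∀ᶠ N : ℝ in atTop, ∀ l ∈ I, 0 < l x → 0 < l (N • x + y) := by
    rw [Finset.eventually_all]
    intro l _
    by_cases hl : 0 < l x
    · filter_upwards [eventually_gt_atTop (-l y / l x)] with N hN _
      rw [div_lt_iff₀ hl] at hN
      rw [map_add, map_smul, smul_eq_mul]
      linarith
    · exact Eventually.of_forall fun _ h => absurd h hl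
  obtain ⟨N, hN, hN'⟩ := ((eventually_gt_atTop 0).and h).exists
  exact ⟨N, hN, hN'⟩

/-- A finite family of integral linear forms on the rational subspace `P`, closed under negation,
none of which vanishes on `P` and which has no common zero on `P` but the origin. -/
structure Arrangement (n : ℕ) (P : Submodule ℝ (Fin n → ℝ)) where
  forms : Finset (Module.Dual ℝ (Fin n → ℝ))
  neg_mem : ∀ l ∈ forms, -l ∈ forms
  integral : ∀ l ∈ forms, IsIntegralForm l
  ne_zero : ∀ l ∈ forms, ∃ x ∈ P, l x ≠ 0
  separating : ∀ x ∈ P, (∀ l ∈ forms, l x = 0) → x = 0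
  rational : IsRationalCone (P : PointedCone ℝ (Fin n → ℝ))

namespace Arrangement

variable {n : ℕ} {P : Submodule ℝ (Fin n → ℝ)}

/-- The sets of forms which define a chamber: from each pair `±l` at least one is chosen. -/
noncomputable def signs (H : Arrangement n P) : Finset (Finset (Module.Dual ℝ (Fin n → ℝ))) := by
  classical exact H.forms.powerset.filter fun I => ∀ l ∈ H.forms, l ∈ I ∨ -l ∈ I

theorem mem_signs {H : Arrangement n P} {I : Finset (Module.Dual ℝ (Fin n → ℝ))} :
    I ∈ H.signs ↔ I ⊆ H.forms ∧ ∀ l ∈ H.forms, l ∈ I ∨ -l ∈ I := by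
  simp [signs]

/-- All chambers and their faces. -/
noncomputable def cones (H : Arrangement n P) : Finset (PointedCone ℝ (Fin n → ℝ)) := by
  classical exact H.signs.image (chamber P)

theorem mem_cones {H : Arrangement n P} {σ : PointedCone ℝ (Fin n → ℝ)} :
    σ ∈ H.cones ↔ ∃ I ∈ H.signs, chamber P I = σ := by
  simp [cones]

theorem filter_mem_signs [DecidableEq (Module.Dual ℝ (Fin n → ℝ))] (H : Arrangement n P)
    {p : Module.Dual ℝ (Fin n → ℝ) → Prop} [DecidablePred p]
    (hp : ∀ l ∈ H.forms, p l ∨ p (-l)) : H.forms.filter p ∈ H.signs := by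
  refine mem_signs.2 ⟨Finset.filter_subset _ _, fun l hl => ?_⟩
  rcases hp l hl with h | h
  · exact Or.inl (Finset.mem_filter.2 ⟨hl, h⟩)
  · exact Or.inr (Finset.mem_filter.2 ⟨H.neg_mem l hl, h⟩)

/-- The face is cut out by all forms of the arrangement that are non-negative on it. If `y`
satisfies these and `x` is relatively interior to `g`, then `N x - y` stays in the chamber for large
`N`, so the face property gives `y ∈ g`. -/
theorem face_mem_cones (H : Arrangement n P) {I : Finset (Module.Dual ℝ (Fin n → ℝ))}
    (hI : I ∈ H.signs) {g : PointedCone ℝ (Fin n → ℝ)} (hg : g.IsFaceOf (chamber P I)) :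
    g ∈ H.cones := by
  classical
  rw [mem_signs] at hI
  set I' := H.forms.filter fun l => ∀ y ∈ g, 0 ≤ l y with hI'
  have hpos : ∀ l ∈ I, ∀ y ∈ g, 0 ≤ l y := fun l hl y hy => (mem_chamber.1 (hg.le hy)).2 l hl
  have hsub : I ⊆ I' := fun l hl => Finset.mem_filter.2 ⟨hI.1 hl, hpos l hl⟩
  refine mem_cones.2 ⟨I', mem_signs.2 ⟨Finset.filter_subset _ _, fun l hl =>
    (hI.2 l hl).imp (fun h => hsub h) (fun h => hsub h)⟩, le_antisymm ?_ ?_⟩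
  · intro y hy
    rw [mem_chamber] at hy
    obtain ⟨x, hx, hx0⟩ := exists_relint g I hpos
    obtain ⟨N, hN, hN'⟩ := exists_large I x (-y)
    have hyI : y ∈ chamber P I := mem_chamber.2 ⟨hy.1, fun l hl => hy.2 l (hsub hl)⟩
    refine hg.mem_of_add_mem_left hyI (y := N • x + -y) ?_ ?_
    · refine mem_chamber.2 ⟨add_mem (P.smul_mem _ (mem_chamber.1 (hg.le hx)).1)
        (P.neg_mem hy.1), fun l hl => ?_⟩
      rcases (hpos l hl x hx).eq_or_lt with h | h
      · have h0 := hx0 l hl h.symm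
        -- A form vanishing on `g` belongs to `I'` with both signs, hence vanishes at `y`.
        have h1 : 0 ≤ (-l) y := hy.2 (-l) (Finset.mem_filter.2 ⟨H.neg_mem l (hI.1 hl), fun z hz => by
          rw [LinearMap.neg_apply, h0 z hz, neg_zero]⟩)
        rw [map_add, map_smul, ← h, smul_zero, zero_add, map_neg]
        exact h1
      · exact (hN' l hl h).le
    · have : y + (N • x + -y) = N • x := by abel
      rw [this]
      exact g.smul_mem hN.le hx
  · intro y hy
    exact mem_chamber.2 ⟨(mem_chamber.1 (hg.le hy)).1, fun l hl => (Finset.mem_filter.1 hl).2 y hy⟩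

theorem inf_isFaceOf (H : Arrangement n P) {I J : Finset (Module.Dual ℝ (Fin n → ℝ))}
    (hI : I ∈ H.signs) (hJ : J ∈ H.signs) :
    (chamber P I ⊓ chamber P J).IsFaceOf (chamber P I) := by
  rw [mem_signs] at hI hJ
  refine PointedCone.IsFaceOf.of_mem_of_add_mem_left inf_le_left fun {x y} hx hy hxy => ?_
  refine ⟨hx, ?_⟩
  have hxy' := mem_chamber.1 hxy.2
  rw [mem_chamber] at hx hy
  refine mem_chamber.2 ⟨hx.1, fun l hl => ?_⟩
  rcases hI.2 l (hJ.1 hl) with h | h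
  · exact hx.2 l h
  · have h1 := hx.2 _ h
    have h2 := hy.2 _ h
    have h3 := hxy'.2 l hl
    rw [LinearMap.neg_apply] at h1 h2
    rw [map_add] at h3
    linarith

theorem isStronglyConvex (H : Arrangement n P) {I : Finset (Module.Dual ℝ (Fin n → ℝ))}
    (hI : I ∈ H.signs) : IsStronglyConvex (chamber P I) := by
  rw [mem_signs] at hI
  intro x hx hx'
  rw [mem_chamber] at hx hx'
  refine H.separating x hx.1 fun l hl => ?_
  rcases hI.2 l hl with h | h
  · have h1 := hx.2 _ h
    have h2 := hx'.2 _ h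
    rw [map_neg] at h2
    linarith
  · have h1 := hx.2 _ h
    have h2 := hx'.2 _ h
    rw [LinearMap.neg_apply] at h1
    rw [LinearMap.neg_apply, map_neg] at h2
    linarith

theorem linSpan_chamber_of_pos {I : Finset (Module.Dual ℝ (Fin n → ℝ))} {z : Fin n → ℝ}
    (hz : z ∈ P) (h : ∀ l ∈ I, 0 < l z) : linSpan (chamber P I) = P := by
  refine le_antisymm (linSpan_le_of_le fun x hx => (mem_chamber.1 hx).1) fun y hy => ?_
  obtain ⟨N, hN, hN'⟩ := exists_large I z y
  have h1 : N • z + y ∈ chamber P I := mem_chamber.2 ⟨add_mem (P.smul_mem _ hz) hy,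
    fun l hl => (hN' l hl (h l hl)).le⟩
  have h2 : z ∈ chamber P I := mem_chamber.2 ⟨hz, fun l hl => (h l hl).le⟩
  have : y = (N • z + y) - N • z := by abel
  rw [this]
  exact sub_mem (mem_linSpan h1) (Submodule.smul_mem _ _ (mem_linSpan h2))

/-- Purity of the fan: a relatively interior point of the chamber is pushed slightly in a direction
of `P` lying on none of the finitely many hyperplanes, and the signs at the new point define `J`. -/
theorem exists_chamber_ge (H : Arrangement n P) {I : Finset (Module.Dual ℝ (Fin n → ℝ))}
    (hI : I ∈ H.signs) :
    ∃ J ∈ H.signs, chamber P I ≤ chamber P J ∧ linSpan (chamber P J) = P := by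
  classical
  have hI' := mem_signs.1 hI
  obtain ⟨x, hx, hx0⟩ := exists_relint (chamber P I) I fun l hl y hy => (mem_chamber.1 hy).2 l hl
  obtain ⟨y, hy, hy0⟩ := Module.Dual.exists_forall_mem_ne_zero_of_forall_exists P
    (fun l : H.forms => (l : Module.Dual ℝ (Fin n → ℝ))) (fun l => H.ne_zero l l.2)
  obtain ⟨N, hN, hN'⟩ := exists_large H.forms x y
  have hneg : ∀ l ∈ H.forms, l x < 0 → l (N • x + y) < 0 := by
    intro l hl h
    have := hN' (-l) (H.neg_mem l hl) (by rw [LinearMap.neg_apply]; linarith)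
    rw [LinearMap.neg_apply] at this
    linarith
  have hzP : N • x + y ∈ P := add_mem (P.smul_mem _ (mem_chamber.1 hx).1) hy
  have hne : ∀ l ∈ H.forms, l (N • x + y) ≠ 0 := by
    intro l hl
    rcases lt_trichotomy (l x) 0 with h | h | h
    · exact (hneg l hl h).ne
    · rw [map_add, map_smul, h, smul_zero, zero_add]
      exact hy0 ⟨l, hl⟩
    · exact (hN' l hl h).ne'
  refine ⟨H.forms.filter fun l => 0 < l (N • x + y), H.filter_mem_signs fun l hl => ?_, ?_,
    linSpan_chamber_of_pos hzP fun l hl => (Finset.mem_filter.1 hl).2⟩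
  · rcases lt_or_gt_of_ne (hne l hl) with h | h
    · right; rw [LinearMap.neg_apply]; linarith
    · left; exact h
  · intro w hw
    have hw' := mem_chamber.1 hw
    refine mem_chamber.2 ⟨hw'.1, fun l hl => ?_⟩
    obtain ⟨hl, hlz⟩ := Finset.mem_filter.1 hl
    rcases lt_trichotomy (l x) 0 with h | h | h
    · exact absurd (hneg l hl h) (not_lt.2 hlz.le)
    · rcases hI'.2 l hl with h1 | h1
      · exact hw'.2 l h1
      · have := hx0 _ h1 (by rw [LinearMap.neg_apply, h, neg_zero]) w hw
        rw [LinearMap.neg_apply] at this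
        linarith
    · rcases hI'.2 l hl with h1 | h1
      · exact hw'.2 l h1
      · have := (mem_chamber.1 hx).2 _ h1
        rw [LinearMap.neg_apply] at this
        linarith

theorem exists_mem_chamber (H : Arrangement n P) {x : Fin n → ℝ} (hx : x ∈ P) :
    ∃ I ∈ H.signs, x ∈ chamber P I := by
  classical
  refine ⟨H.forms.filter fun l => 0 ≤ l x, H.filter_mem_signs fun l _ => ?_,
    mem_chamber.2 ⟨hx, fun l hl => (Finset.mem_filter.1 hl).2⟩⟩
  rw [LinearMap.neg_apply]
  rcases le_total 0 (l x) with h | h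
  · left; exact h
  · right; linarith

/-- The fan of the arrangement, with all weights equal to one. -/
noncomputable def fan (H : Arrangement n P) {k : ℕ} (hk : Module.finrank ℝ P = k) :
    WeightedFan n k where
  cones := H.cones
  nonempty := by
    obtain ⟨I, hI, -⟩ := H.exists_mem_chamber P.zero_mem
    exact ⟨_, mem_cones.2 ⟨I, hI, rfl⟩⟩
  rational := by
    intro σ hσ
    obtain ⟨I, hI, rfl⟩ := mem_cones.1 hσ
    exact isRationalCone_chamber H.rational fun l hl => H.integral l ((mem_signs.1 hI).1 hl)
  stronglyConvex := by
    intro σ hσ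
    obtain ⟨I, hI, rfl⟩ := mem_cones.1 hσ
    exact H.isStronglyConvex hI
  face_mem := by
    intro σ hσ τ hτ
    obtain ⟨I, hI, rfl⟩ := mem_cones.1 hσ
    exact H.face_mem_cones hI hτ
  inter_face := by
    intro σ₁ h₁ σ₂ h₂
    obtain ⟨I, hI, rfl⟩ := mem_cones.1 h₁
    obtain ⟨J, hJ, rfl⟩ := mem_cones.1 h₂
    exact ⟨H.inf_isFaceOf hI hJ, by rw [inf_comm]; exact H.inf_isFaceOf hJ hI⟩
  pure := by
    intro σ hσ hmax
    obtain ⟨I, hI, rfl⟩ := mem_cones.1 hσ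
    obtain ⟨J, hJ, hle, hJP⟩ := H.exists_chamber_ge hI
    rw [← hmax _ (mem_cones.2 ⟨J, hJ, rfl⟩) hle, dim, hJP, hk]
  -- Balancing is not needed: a common refinement only has to be a weighted fan.
  weight := fun _ => 1

theorem support_fan (H : Arrangement n P) {k : ℕ} (hk : Module.finrank ℝ P = k) :
    (H.fan hk).support = P := by
  ext x
  constructor
  · rintro ⟨σ, hσ, -, hx⟩
    obtain ⟨I, -, rfl⟩ := mem_cones.1 (WeightedFan.mem_facets.1 hσ).1
    exact (mem_chamber.1 hx).1
  · intro hx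
    obtain ⟨I, hI, hxI⟩ := H.exists_mem_chamber hx
    obtain ⟨J, hJ, hle, hJP⟩ := H.exists_chamber_ge hI
    exact ⟨chamber P J, WeightedFan.mem_facets.2 ⟨mem_cones.2 ⟨J, hJ, rfl⟩, by
      rw [dim, hJP, hk]⟩, one_ne_zero, hle hxI⟩

end Arrangement

/-! ### Common refinements of fans whose support is a plane -/

/-- The bilinear form `(x, y) ↦ xᵢ yⱼ - xⱼ yᵢ`. -/
def minorForm {n : ℕ} (i j : Fin n) (x : Fin n → ℝ) : Module.Dual ℝ (Fin n → ℝ) :=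
  x i • LinearMap.proj j - x j • LinearMap.proj i

theorem minorForm_apply {n : ℕ} (i j : Fin n) (x y : Fin n → ℝ) :
    minorForm i j x y = x i * y j - x j * y i := rfl

theorem minorForm_swap {n : ℕ} (i j : Fin n) (x y : Fin n → ℝ) :
    minorForm i j x y = -minorForm i j y x := by
  rw [minorForm_apply, minorForm_apply]; ring

theorem minorForm_self {n : ℕ} (i j : Fin n) (x : Fin n → ℝ) : minorForm i j x x = 0 := by
  rw [minorForm_apply]; ring

theorem isIntegralForm_minorForm {n : ℕ} (i j : Fin n) (s : Fin n → ℤ) :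
    IsIntegralForm (minorForm i j (toReal n s)) := fun z =>
  ⟨s i * z j - s j * z i, by rw [minorForm_apply]; push_cast; rfl⟩

theorem exists_basis_plane {n : ℕ} {P : Submodule ℝ (Fin n → ℝ)} (hP2 : Module.finrank ℝ P = 2) :
    ∃ a ∈ P, ∃ b ∈ P, a ≠ 0 ∧ b ∉ Submodule.span ℝ {a} := by
  have h1 : P ≠ ⊥ := by
    rintro rfl
    rw [finrank_bot] at hP2
    omega
  obtain ⟨a, ha, ha0⟩ := P.exists_mem_ne_zero_of_ne_bot h1
  refine ⟨a, ha, ?_⟩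
  by_contra! hc
  have h2 : P ≤ Submodule.span ℝ {a} := fun b hb => hc b hb ha0
  have h3 := Submodule.finrank_mono h2
  rw [finrank_span_singleton ha0] at h3
  omega

/-- A non-zero `2 × 2` minor of a basis of `P` gives a non-degenerate alternating form on `P`; the
identity is Cramer's rule. -/
theorem exists_minorForm {n : ℕ} {P : Submodule ℝ (Fin n → ℝ)} (hP2 : Module.finrank ℝ P = 2) :
    ∃ i j : Fin n, (∀ a ∈ P, ∀ b ∈ P, ∀ x ∈ P, minorForm i j a b • x =
      minorForm i j x b • a + minorForm i j a x • b) ∧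
      ∀ a ∈ P, a ≠ 0 → ∃ b ∈ P, minorForm i j a b ≠ 0 := by
  obtain ⟨a, ha, b, hb, ha0, hab⟩ := exists_basis_plane hP2
  have hex : ∃ i j, a i * b j - a j * b i ≠ 0 := by
    by_contra! hc
    obtain ⟨i, hi⟩ := Function.ne_iff.1 ha0
    refine hab (Submodule.mem_span_singleton.2 ⟨b i / a i, ?_⟩)
    ext j
    have := hc i j
    have hi' : a i ≠ 0 := hi
    simp only [Pi.smul_apply, smul_eq_mul]
    field_simp
    linarith
  obtain ⟨i, j, hij⟩ := hex
  have rep : ∀ x ∈ P, ∃ α β : ℝ, x = α • a + β • b := fun x hx =>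
    WeightedFan.exists_eq_add_smul hP2 ha0 ha hb hx hab
  refine ⟨i, j, ?_, ?_⟩
  · intro x hx y hy z hz
    obtain ⟨α, β, rfl⟩ := rep x hx
    obtain ⟨γ, δ, rfl⟩ := rep y hy
    obtain ⟨ε, ζ, rfl⟩ := rep z hz
    ext k
    simp only [minorForm_apply, Pi.add_apply, Pi.smul_apply, smul_eq_mul]
    ring
  · intro x hx hx0
    obtain ⟨α, β, rfl⟩ := rep x hx
    by_contra! hc
    have h1 := hc b hb
    have h2 := hc a ha
    simp only [minorForm_apply, Pi.add_apply, Pi.smul_apply, smul_eq_mul] at h1 h2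
    have h3 : α * (a i * b j - a j * b i) = 0 := by linarith
    have h4 : β * (a i * b j - a j * b i) = 0 := by linarith
    rw [(mul_eq_zero.1 h3).resolve_right hij, (mul_eq_zero.1 h4).resolve_right hij] at hx0
    simp at hx0

/-- A chamber of the arrangement lies in the cone spanned by `S` as soon as a point of the
chamber, on none of the lines spanned by `S`, does. -/
theorem chamber_le_hull {n : ℕ} {P : Submodule ℝ (Fin n → ℝ)} {i j : Fin n}
    (hD : ∀ a ∈ P, ∀ b ∈ P, ∀ x ∈ P, minorForm i j a b • x =
      minorForm i j x b • a + minorForm i j a x • b)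
    {S : Finset (Fin n → ℤ)} (hSP : ∀ s ∈ S, toReal n s ∈ P)
    (hS : IsStronglyConvex (PointedCone.hull ℝ (toReal n '' (S : Set (Fin n → ℤ)))))
    {I : Finset (Module.Dual ℝ (Fin n → ℝ))}
    (hI : ∀ s ∈ S, s ≠ 0 → minorForm i j (toReal n s) ∈ I ∨ -minorForm i j (toReal n s) ∈ I)
    {x : Fin n → ℝ} (hx : x ∈ chamber P I) (hx0 : x ≠ 0)
    (hxS : x ∈ PointedCone.hull ℝ (toReal n '' (S : Set (Fin n → ℤ))))
    (hne : ∀ s ∈ S, s ≠ 0 → minorForm i j (toReal n s) x ≠ 0) :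
    chamber P I ≤ PointedCone.hull ℝ (toReal n '' (S : Set (Fin n → ℤ))) := by
  set σ := PointedCone.hull ℝ (toReal n '' (S : Set (Fin n → ℤ))) with hσ
  obtain ⟨c, hc, hxc⟩ := mem_hull_iff.1 hxS
  have hsum : ∑ s ∈ S, c s * minorForm i j (toReal n s) x = 0 := by
    have h1 : minorForm i j x (∑ s ∈ S, c s • toReal n s) = 0 := by
      rw [← hxc, minorForm_self]
    rw [map_sum] at h1
    rw [← neg_eq_zero, ← Finset.sum_neg_distrib, ← h1]
    refine Finset.sum_congr rfl fun s _ => ?_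
    rw [map_smul, minorForm_swap i j x, smul_eq_mul, mul_neg]
  have hex : ∃ s ∈ S, c s * minorForm i j (toReal n s) x ≠ 0 := by
    by_contra! h
    refine hx0 (hxc.trans (Finset.sum_eq_zero fun s hs => ?_))
    by_cases hs0 : s = 0
    · rw [hs0, map_zero, smul_zero]
    · rw [(mul_eq_zero.1 (h s hs)).resolve_right (hne s hs hs0), zero_smul]
  -- Pairing `x` with itself gives a vanishing sum with non-zero terms, so there are generators `a`
  -- and `b` strictly on opposite sides of the line through `x`.
  obtain ⟨a, ha, hax⟩ := Finset.exists_pos_of_sum_zero_of_exists_nonzero _ hsum hex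
  obtain ⟨b, hb, hbx⟩ := Finset.exists_pos_of_sum_zero_of_exists_nonzero
    (fun s => -(c s * minorForm i j (toReal n s) x))
    (by rw [Finset.sum_neg_distrib, hsum, neg_zero])
    (by obtain ⟨s, hs, h⟩ := hex; exact ⟨s, hs, neg_ne_zero.2 h⟩)
  replace hax : 0 < minorForm i j (toReal n a) x := pos_of_mul_pos_right hax (hc a)
  replace hbx : 0 < minorForm i j x (toReal n b) := by
    rw [minorForm_swap]
    rw [← mul_neg] at hbx
    exact pos_of_mul_pos_right hbx (hc b)
  have haσ : toReal n a ∈ σ := toReal_mem_hull ha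
  have hbσ : toReal n b ∈ σ := toReal_mem_hull hb
  have hxP := (mem_chamber.1 hx).1
  have hid := hD _ (hSP a ha) _ (hSP b hb) x hxP
  have ha0 : a ≠ 0 := by
    rintro rfl
    simp [minorForm_apply] at hax
  have hb0 : b ≠ 0 := by
    rintro rfl
    simp [minorForm_apply] at hbx
  -- Otherwise Cramer's rule would put a positive combination of `a` and `b` in both `σ` and `-σ`.
  have hab : 0 < minorForm i j (toReal n a) (toReal n b) := by
    by_contra! hle
    have m1 : minorForm i j (toReal n a) (toReal n b) • x ∈ σ := by
      rw [hid]
      exact add_mem (σ.smul_mem hbx.le haσ) (σ.smul_mem hax.le hbσ)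
    have m2 : -(minorForm i j (toReal n a) (toReal n b) • x) ∈ σ := by
      rw [← neg_smul]
      exact σ.smul_mem (by linarith) hxS
    have h0 := hS _ m1 m2
    rw [hid] at h0
    have h1 := hS _ (σ.smul_mem hbx.le haσ) (by
      rw [neg_eq_of_add_eq_zero_right h0]
      exact σ.smul_mem hax.le hbσ)
    refine ha0 (toReal_injective n ?_)
    rw [map_zero]
    exact (smul_eq_zero.1 h1).resolve_left hbx.ne'
  intro y hy
  have hy' := mem_chamber.1 hy
  have hx' := mem_chamber.1 hx
  have hay : 0 ≤ minorForm i j (toReal n a) y := by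
    rcases hI a ha ha0 with h | h
    · exact hy'.2 _ h
    · have := hx'.2 _ h
      rw [LinearMap.neg_apply] at this
      linarith
  have hby : 0 ≤ minorForm i j y (toReal n b) := by
    rw [minorForm_swap] at hbx ⊢
    rcases hI b hb hb0 with h | h
    · have := hx'.2 _ h
      linarith
    · exact hy'.2 _ h
  have : y = (minorForm i j (toReal n a) (toReal n b))⁻¹ •
      (minorForm i j y (toReal n b) • toReal n a + minorForm i j (toReal n a) y • toReal n b) := by
    rw [← hD _ (hSP a ha) _ (hSP b hb) y hy'.1, smul_smul, inv_mul_cancel₀ hab.ne', one_smul]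
  rw [this]
  exact σ.smul_mem (inv_nonneg.2 hab.le) (add_mem (σ.smul_mem hby haσ) (σ.smul_mem hay hbσ))

variable {n : ℕ} {P : Submodule ℝ (Fin n → ℝ)}

/-- The arrangement of the lines in a plane spanned by finitely many lattice vectors. -/
noncomputable def lineArrangement (i j : Fin n) (S : Finset (Fin n → ℤ))
    (hD : ∀ a ∈ P, a ≠ 0 → ∃ b ∈ P, minorForm i j a b ≠ 0)
    (hSP : Submodule.span ℝ (toReal n '' (S : Set (Fin n → ℤ))) = P)
    (hP : IsRationalCone (P : PointedCone ℝ (Fin n → ℝ))) : Arrangement n P := by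
  classical exact
  { forms := (S.filter fun s => s ≠ 0).image (fun s => minorForm i j (toReal n s)) ∪
      (S.filter fun s => s ≠ 0).image (fun s => -minorForm i j (toReal n s))
    neg_mem := by
      intro l hl
      simp only [Finset.mem_union, Finset.mem_image] at hl ⊢
      rcases hl with ⟨s, hs, rfl⟩ | ⟨s, hs, rfl⟩
      · exact Or.inr ⟨s, hs, rfl⟩
      · exact Or.inl ⟨s, hs, (neg_neg _).symm⟩
    integral := by
      intro l hl
      simp only [Finset.mem_union, Finset.mem_image] at hl
      rcases hl with ⟨s, hs, rfl⟩ | ⟨s, hs, rfl⟩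
      · exact isIntegralForm_minorForm i j s
      · exact (isIntegralForm_minorForm i j s).neg
    ne_zero := by
      intro l hl
      have key : ∀ s ∈ S.filter (fun s => s ≠ 0), ∃ x ∈ P, minorForm i j (toReal n s) x ≠ 0 := by
        intro s hs
        rw [Finset.mem_filter] at hs
        refine hD _ (hSP ▸ Submodule.subset_span ⟨s, hs.1, rfl⟩) fun h => hs.2 ?_
        exact toReal_injective n (by rw [h, map_zero])
      simp only [Finset.mem_union, Finset.mem_image] at hl
      rcases hl with ⟨s, hs, rfl⟩ | ⟨s, hs, rfl⟩
      · exact key s hs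
      · obtain ⟨x, hx, h⟩ := key s hs
        exact ⟨x, hx, neg_ne_zero.2 h⟩
    separating := by
      intro x hx h
      by_contra hx0
      obtain ⟨b, hb, hxb⟩ := hD x hx hx0
      apply hxb
      clear hxb
      rw [← hSP] at hb
      induction hb using Submodule.span_induction with
      | mem y hy =>
        obtain ⟨s, hs, rfl⟩ := hy
        by_cases hs0 : s = 0
        · rw [hs0, map_zero, map_zero]
        · rw [minorForm_swap, h _ (Finset.mem_union_left _ (Finset.mem_image_of_mem _
            (Finset.mem_filter.2 ⟨hs, hs0⟩))), neg_zero]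
      | zero => exact map_zero _
      | add y z _ _ hy hz => rw [map_add, hy, hz, add_zero]
      | smul c y _ hy => rw [map_smul, hy, smul_zero]
    rational := hP }

theorem mem_lineArrangement {i j : Fin n} {S : Finset (Fin n → ℤ)}
    {hD : ∀ a ∈ P, a ≠ 0 → ∃ b ∈ P, minorForm i j a b ≠ 0}
    {hSP : Submodule.span ℝ (toReal n '' (S : Set (Fin n → ℤ))) = P}
    {hP : IsRationalCone (P : PointedCone ℝ (Fin n → ℝ))} {s : Fin n → ℤ} (hs : s ∈ S)
    (hs0 : s ≠ 0) : minorForm i j (toReal n s) ∈ (lineArrangement i j S hD hSP hP).forms := by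
  classical
  exact Finset.mem_union_left _ (Finset.mem_image_of_mem _ (Finset.mem_filter.2 ⟨hs, hs0⟩))

/-- An interior point of a two-dimensional chamber lies on none of the lines and in some active
facet; `chamber_le_hull` then puts the whole chamber in that facet. -/
theorem lineArrangement_refines (hP2 : Module.finrank ℝ P = 2) {i j : Fin n}
    {S : Finset (Fin n → ℤ)}
    (hDD : ∀ a ∈ P, ∀ b ∈ P, ∀ x ∈ P, minorForm i j a b • x =
      minorForm i j x b • a + minorForm i j a x • b)
    (hD : ∀ a ∈ P, a ≠ 0 → ∃ b ∈ P, minorForm i j a b ≠ 0)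
    (hSP : Submodule.span ℝ (toReal n '' (S : Set (Fin n → ℤ))) = P)
    (hPr : IsRationalCone (P : PointedCone ℝ (Fin n → ℝ)))
    {F : WeightedFan n 2} (hP : F.support = P) (hF : ∀ σ ∈ F.activeFacets, F.weight σ = 1)
    (hS : ∀ σ ∈ F.activeFacets, ∃ S' ⊆ S,
      σ = PointedCone.hull ℝ (toReal n '' (S' : Set (Fin n → ℤ)))) :
    ((lineArrangement i j S hD hSP hPr).fan hP2).Refines F := by
  set H := lineArrangement i j S hD hSP hPr
  refine ⟨by rw [H.support_fan, hP], fun ρ hρ _ => ?_⟩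
  rw [WeightedFan.mem_facets] at hρ
  obtain ⟨I, hI, rfl⟩ := Arrangement.mem_cones.1 hρ.1
  have hspan : linSpan (chamber P I) = P :=
    linSpan_eq_of_le (fun x hx => (mem_chamber.1 hx).1) (by rw [hP2, hρ.2])
  obtain ⟨x, hx, hx0⟩ := exists_relint (chamber P I) I fun l hl y hy => (mem_chamber.1 hy).2 l hl
  have hI' := Arrangement.mem_signs.1 hI
  have hne : ∀ l ∈ H.forms, l x ≠ 0 := by
    intro l hl h0
    have hz : ∀ y ∈ chamber P I, l y = (0 : Module.Dual ℝ (Fin n → ℝ)) y := by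
      intro y hy
      rcases hI'.2 l hl with h | h
      · exact hx0 l h h0 y hy
      · have := hx0 _ h (by rw [LinearMap.neg_apply, h0, neg_zero]) y hy
        rw [LinearMap.neg_apply, neg_eq_zero] at this
        exact this
    obtain ⟨y, hy, hy0⟩ := H.ne_zero l hl
    exact hy0 (dual_eq_of_mem_linSpan hz (hspan.symm ▸ hy))
  have hxne : x ≠ 0 := by
    rintro rfl
    obtain ⟨a, ha, -, -, ha0, -⟩ := exists_basis_plane hP2
    exact ha0 (H.separating a ha fun l hl => absurd (map_zero l) (hne l hl))
  obtain ⟨σ, hσ, hxσ⟩ := WeightedFan.exists_activeFacet hP (mem_chamber.1 hx).1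
  have m := (WeightedFan.mem_activeFacets.1 hσ).1
  refine ⟨σ, WeightedFan.mem_facets.2 m, ?_, hF σ hσ⟩
  obtain ⟨S', hS', hσS'⟩ := hS σ hσ
  have hsc := F.stronglyConvex σ m.1
  rw [hσS'] at hsc hxσ ⊢
  exact chamber_le_hull hDD (fun s hs => hSP ▸ Submodule.subset_span ⟨s, hS' hs, rfl⟩) hsc
    (fun s hs hs0 => hI'.2 _ (mem_lineArrangement (hS' hs) hs0)) hx hxne hxσ
    (fun s hs hs0 => hne _ (mem_lineArrangement (hS' hs) hs0))

/-- A cycle of multiplicity one whose support is a plane is determined by the plane. -/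
theorem TropicalFan.cycle_eq (hP2 : Module.finrank ℝ P = 2) {F G : TropicalFan n 2}
    (hFP : F.support = P) (hGP : G.support = P) (hF : ∀ σ ∈ F.activeFacets, F.weight σ = 1)
    (hG : ∀ σ ∈ G.activeFacets, G.weight σ = 1) : F.cycle = G.cycle := by
  classical
  obtain ⟨i, j, hDD, hD⟩ := exists_minorForm hP2
  have hr : ∀ σ : PointedCone ℝ (Fin n → ℝ), ∃ S : Finset (Fin n → ℤ), IsRationalCone σ →
      σ = PointedCone.hull ℝ (toReal n '' (S : Set (Fin n → ℤ))) := by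
    intro σ
    by_cases h : IsRationalCone σ
    · obtain ⟨S, hS⟩ := h
      exact ⟨S, fun _ => hS⟩
    · exact ⟨∅, fun h' => absurd h' h⟩
  choose S hS using hr
  -- The arrangement uses the generators of the active facets of both fans, so that it refines both.
  set A := F.activeFacets ∪ G.activeFacets with hA
  have hAr : ∀ σ ∈ A, IsRationalCone σ ∧ linSpan σ = P := by
    intro σ hσ
    rcases Finset.mem_union.1 hσ with h | h
    · exact ⟨F.rational σ (WeightedFan.mem_activeFacets.1 h).1.1,
        WeightedFan.linSpan_activeFacet hFP hP2 h⟩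
    · exact ⟨G.rational σ (WeightedFan.mem_activeFacets.1 h).1.1,
        WeightedFan.linSpan_activeFacet hGP hP2 h⟩
  have hSA : ∀ σ ∈ A, S σ ⊆ A.biUnion S := fun σ hσ => Finset.subset_biUnion_of_mem S hσ
  obtain ⟨σ₀, hσ₀, -⟩ := WeightedFan.exists_activeFacet hFP P.zero_mem
  have hσ₀A : σ₀ ∈ A := Finset.mem_union_left _ hσ₀
  have hsp : ∀ σ ∈ A, Submodule.span ℝ (toReal n '' (S σ : Set (Fin n → ℤ))) = P := by
    intro σ hσ
    have h := hS σ (hAr σ hσ).1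
    rw [← linSpan_hull, ← h, (hAr σ hσ).2]
  have hSP : Submodule.span ℝ (toReal n '' (A.biUnion S : Set (Fin n → ℤ))) = P := by
    apply le_antisymm
    · refine Submodule.span_le.2 ?_
      rintro _ ⟨s, hs, rfl⟩
      obtain ⟨σ, hσ, hsσ⟩ := Finset.mem_biUnion.1 (Finset.mem_coe.1 hs)
      exact hsp σ hσ ▸ Submodule.subset_span ⟨s, hsσ, rfl⟩
    · refine (hsp σ₀ hσ₀A).ge.trans (Submodule.span_mono (Set.image_mono ?_))
      exact_mod_cast hSA σ₀ hσ₀A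
  have hPr : IsRationalCone (P : PointedCone ℝ (Fin n → ℝ)) := by
    rw [← (hAr σ₀ hσ₀A).2]
    exact isRationalCone_linSpan (hAr σ₀ hσ₀A).1
  have hgen : ∀ σ ∈ A, ∃ S' ⊆ A.biUnion S,
      σ = PointedCone.hull ℝ (toReal n '' (S' : Set (Fin n → ℤ))) := fun σ hσ =>
    ⟨S σ, hSA σ hσ, hS σ (hAr σ hσ).1⟩
  exact Quot.sound ⟨(lineArrangement i j (A.biUnion S) hD hSP hPr).fan hP2,
    lineArrangement_refines hP2 hDD hD hSP hPr hFP hF fun σ hσ =>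
      hgen σ (Finset.mem_union_left _ hσ),
    lineArrangement_refines hP2 hDD hD hSP hPr hGP hG fun σ hσ =>
      hgen σ (Finset.mem_union_right _ hσ)⟩

/-! ### Maxima of linear forms -/

section Max

variable {n r : ℕ} {l : Fin (r + 1) → Module.Dual ℤ (Fin n → ℤ)}

theorem realForm_apply (f : Module.Dual ℤ (Fin n → ℤ)) (x : Fin n → ℝ) :
    realForm f x = ∑ i, (f (Pi.single i 1) : ℝ) * x i := by
  simp [realForm]

theorem realForm_zero : realForm (0 : Module.Dual ℤ (Fin n → ℤ)) = 0 := by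
  simp [realForm]

theorem realForm_toReal (f : Module.Dual ℤ (Fin n → ℤ)) (z : Fin n → ℤ) :
    realForm f (toReal n z) = (f z : ℝ) := by
  rw [realForm_apply]
  conv_rhs => rw [← Finset.univ_sum_single z, map_sum]
  push_cast
  refine Finset.sum_congr rfl fun i _ => ?_
  have : Pi.single i (z i) = z i • (Pi.single i 1 : Fin n → ℤ) := by
    rw [← Pi.single_smul, smul_eq_mul, mul_one]
  rw [this, map_smul, smul_eq_mul, Int.cast_mul, mul_comm]
  rfl

theorem le_max (i : Fin (r + 1)) (x : Fin n → ℝ) :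
    realForm (l i) x ≤ (TRFunction.max l).toFun x :=
  Finset.le_sup' (fun i => realForm (l i) x) (Finset.mem_univ i)

theorem exists_eq_max (x : Fin n → ℝ) :
    ∃ i, (TRFunction.max l).toFun x = realForm (l i) x := by
  obtain ⟨i, -, hi⟩ := Finset.exists_mem_eq_sup' Finset.univ_nonempty
    (fun i => realForm (l i) x)
  exact ⟨i, hi⟩

theorem max_nonneg (h0 : l 0 = 0) (x : Fin n → ℝ) : 0 ≤ (TRFunction.max l).toFun x := by
  have := le_max (l := l) 0 x
  rwa [h0, realForm_zero, LinearMap.zero_apply] at this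

theorem max_eq_zero {x : Fin n → ℝ} (h : ∀ i, realForm (l i) x = 0) :
    (TRFunction.max l).toFun x = 0 := by
  obtain ⟨i, hi⟩ := exists_eq_max (l := l) x
  rw [hi, h]

/-- If the maximum agrees with a linear form at `x` and `-x`, then all forms vanish at `x`. -/
theorem realForm_eq_zero_of_max_add_max_neg_le (h0 : l 0 = 0) {x : Fin n → ℝ}
    (h : (TRFunction.max l).toFun x + (TRFunction.max l).toFun (-x) ≤ 0) (i : Fin (r + 1)) :
    realForm (l i) x = 0 := by
  have h1 := max_nonneg h0 x
  have h2 := max_nonneg h0 (-x)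
  have h3 := le_max (l := l) i x
  have h4 := le_max (l := l) i (-x)
  rw [map_neg] at h4
  linarith

variable {P : Submodule ℝ (Fin n → ℝ)}

/-- If the product of `max l` with `T · L` vanishes, then all forms vanish on the corner locus
of `T`. -/
theorem HasIntersectionNumber.realForm_eq_zero (h0 : l 0 = 0) {T : TRFunction n} {L : Cycle n 2}
    (h : HasIntersectionNumber (TRFunction.max l) T L 0) (hP : L.support = P)
    (hP2 : Module.finrank ℝ P = 2) {x : Fin n → ℝ} (hxP : x ∈ P) (hx0 : x ≠ 0)
    (hx : ¬ LocallyLinearAt T.toFun P x) (i : Fin (r + 1)) : realForm (l i) x = 0 := by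
  obtain ⟨A, ω, u, -, -, hω, hs, hd, -, hu, -⟩ := h.exists_rays hP hP2
  obtain ⟨τ, hτ, c, hc, rfl⟩ := hu x hxP hx0 hx
  have hωpos : ∀ τ ∈ A, (0 : ℝ) < ω τ := fun τ hτ => by
    exact_mod_cast Nat.pos_of_ne_zero (hω τ hτ)
  -- A vanishing sum of non-negative terms makes the maximum zero on each ray. The weighted values
  -- of each single form are then `≤ 0` and sum to zero by balancing.
  have hle : ∀ τ ∈ A, realForm (l i) (toReal n (u τ)) ≤ 0 := by
    intro τ hτ
    rw [Nat.cast_zero, Finset.sum_eq_zero_iff_of_nonneg fun τ _ =>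
      mul_nonneg (Nat.cast_nonneg _) (max_nonneg h0 _)] at hd
    have := (mul_eq_zero.1 (hd τ hτ)).resolve_left (hωpos τ hτ).ne'
    rw [← this]
    exact le_max i _
  have hsum := congrArg (realForm (l i)) hs
  rw [map_sum, map_zero, Finset.sum_eq_zero_iff_of_nonpos fun τ hτ => by
    rw [map_smul, smul_eq_mul]
    exact mul_nonpos_of_nonneg_of_nonpos (hωpos τ hτ).le (hle τ hτ)] at hsum
  have := hsum τ hτ
  rw [map_smul, smul_eq_mul] at this
  rw [map_smul, (mul_eq_zero.1 this).resolve_left (hωpos τ hτ).ne', smul_zero]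

/-- On the connected set `P ∖ {0}` the maximum is one linear form, so its values at `x` and `-x`
cancel. -/
theorem realForm_eq_zero_of_locallyLinearAt (h0 : l 0 = 0) (hP2 : Module.finrank ℝ P = 2)
    (h : ∀ x ∈ P, x ≠ 0 → LocallyLinearAt (TRFunction.max l).toFun P x) {x : Fin n → ℝ}
    (hx : x ∈ P) (i : Fin (r + 1)) : realForm (l i) x = 0 := by
  by_cases hx0 : x = 0
  · rw [hx0, map_zero]
  obtain ⟨f, hf⟩ := exists_dual_of_locallyLinearAt (isPreconnected_plane_diff_zero hP2)
    Set.sdiff_subset (fun y hy => h y hy.1 hy.2) ⟨hx, hx0⟩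
  refine realForm_eq_zero_of_max_add_max_neg_le h0 ?_ i
  rw [hf x ⟨hx, hx0⟩, hf (-x) ⟨P.neg_mem hx, neg_ne_zero.2 hx0⟩, map_neg, add_neg_cancel]

end Max

/-! ### Linear algebra: a transversal coordinate on a plane, and independence over the reals -/

theorem exists_coordinate {n : ℕ} {P : Submodule ℝ (Fin n → ℝ)} (hP2 : Module.finrank ℝ P = 2)
    {u a : Fin n → ℝ} (hu : u ∈ P) (hu0 : u ≠ 0) (ha : a ∈ P)
    (hau : a ∉ Submodule.span ℝ {u}) :
    ∃ f : Module.Dual ℝ (Fin n → ℝ), f u = 0 ∧ f a = 1 ∧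
      ∀ y ∈ P, ∃ α : ℝ, y = α • u + f y • a := by
  obtain ⟨f, hfa, hfu⟩ := Submodule.exists_le_ker_of_notMem hau
  have hfu' : f u = 0 := hfu (Submodule.mem_span_singleton_self u)
  have h1 : ((f a)⁻¹ • f) u = 0 := by rw [LinearMap.smul_apply, hfu', smul_zero]
  have h2 : ((f a)⁻¹ • f) a = 1 := by
    rw [LinearMap.smul_apply, smul_eq_mul, inv_mul_cancel₀ hfa]
  refine ⟨(f a)⁻¹ • f, h1, h2, fun y hy => ?_⟩
  obtain ⟨α, β, hy'⟩ := WeightedFan.exists_eq_add_smul hP2 hu0 hu ha hy hau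
  refine ⟨α, ?_⟩
  have : ((f a)⁻¹ • f) y = β := by
    rw [hy', map_add, map_smul, map_smul, h1, h2]
    simp
  rw [this]
  exact hy'

/-- As many forms as coordinates: the coefficient matrix is square, and its non-zero integral
determinant stays non-zero over `ℝ`. -/
theorem eq_zero_of_linearIndependent {k m : ℕ}
    {φ : Fin k ⊕ Fin m → Module.Dual ℤ (Fin (k + m) → ℤ)} (h : LinearIndependent ℤ φ)
    {x : Fin (k + m) → ℝ} (hx : ∀ i, realForm (φ i) x = 0) : x = 0 := by
  let M : Matrix (Fin (k + m)) (Fin (k + m)) ℤ := fun i j =>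
    φ (finSumFinEquiv.symm i) (Pi.single j 1)
  have hdet : M.det ≠ 0 := by
    intro h0
    obtain ⟨c, hc, hcM⟩ := Matrix.exists_vecMul_eq_zero_iff.2 h0
    have h' : LinearIndependent ℤ fun i => φ (finSumFinEquiv.symm i) :=
      h.comp _ finSumFinEquiv.symm.injective
    rw [Fintype.linearIndependent_iff] at h'
    refine hc (funext (h' c ?_))
    refine LinearMap.pi_ext' fun j => LinearMap.ext_ring ?_
    have := congrFun hcM j
    simpa [Matrix.vecMul, dotProduct, M] using this
  have hdet' : (M.map (Int.cast : ℤ → ℝ)).det ≠ 0 := by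
    have : (M.map (Int.cast : ℤ → ℝ)).det = (M.det : ℝ) := by
      simpa using (RingHom.map_det (Int.castRingHom ℝ) M).symm
    rw [this]
    exact_mod_cast hdet
  refine Matrix.eq_zero_of_mulVec_eq_zero hdet' (funext fun i => ?_)
  have := hx (finSumFinEquiv.symm i)
  rw [realForm_apply] at this
  exact this

/-! ### Planes with prescribed intersection numbers -/

section Final

variable {n k m : ℕ} {v : Fin (k + 1) → Module.Dual ℤ (Fin n → ℤ)}
  {w : Fin (m + 1) → Module.Dual ℤ (Fin n → ℤ)}

/-- `h₁₂` and `h₂₂` kill all forms on the corner locus of `max w`, so it is empty and the `w j`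
vanish on `P`. Then `h₁₁` does the same for the `v i`. -/
theorem not_exists_zero_zero_zero (hv : v 0 = 0) (hw : w 0 = 0)
    (hvw : ∀ x : Fin n → ℝ, (∀ i, realForm (v i) x = 0) → (∀ j, realForm (w j) x = 0) → x = 0)
    {L : Cycle n 2} (hL : L.SupportIsPlane)
    (h₁₂ : HasIntersectionNumber (TRFunction.max v) (TRFunction.max w) L 0)
    (h₁₁ : HasIntersectionNumber (TRFunction.max v) (TRFunction.max v) L 0)
    (h₂₂ : HasIntersectionNumber (TRFunction.max w) (TRFunction.max w) L 0) : False := by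
  obtain ⟨P, hP2, hP⟩ := hL
  have hw0 : ∀ x ∈ P, ∀ j, realForm (w j) x = 0 := fun x hx =>
    realForm_eq_zero_of_locallyLinearAt hw hP2 (fun y hy hy0 => by
      by_contra hn
      exact hy0 (hvw y (h₁₂.realForm_eq_zero hv hP hP2 hy hy0 hn)
        (h₂₂.realForm_eq_zero hw hP hP2 hy hy0 hn))) hx
  have hv0 : ∀ x ∈ P, ∀ i, realForm (v i) x = 0 := fun x hx =>
    realForm_eq_zero_of_locallyLinearAt hv hP2 (fun y hy hy0 => by
      by_contra hn
      exact hy0 (hvw y (h₁₁.realForm_eq_zero hv hP hP2 hy hy0 hn) (hw0 y hy))) hx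
  obtain ⟨a, ha, -, -, ha0, -⟩ := exists_basis_plane hP2
  exact ha0 (hvw a (hv0 a ha) (hw0 a ha))

/-- At a corner point `u ≠ 0` of `T` all `v i` vanish, so on `P` they depend on one coordinate.
Corners of `max v` then lie on the line of `u`, where it is zero. -/
theorem not_exists_zero_one_one (hv : v 0 = 0) {T : TRFunction n}
    {L : Cycle n 2} (hL : L.SupportIsPlane)
    (h₁₂ : HasIntersectionNumber (TRFunction.max v) T L 0)
    (h₁₁ : HasIntersectionNumber (TRFunction.max v) (TRFunction.max v) L 1)
    (h₂₂ : HasIntersectionNumber T T L 1) : False := by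
  obtain ⟨P, hP2, hP⟩ := hL
  obtain ⟨u, huP, hu0, hu⟩ : ∃ u ∈ P, u ≠ 0 ∧ ¬ LocallyLinearAt T.toFun P u := by
    obtain ⟨A, ω, u, -, -, -, -, hd, hu, -⟩ := h₂₂.exists_rays hP hP2
    obtain ⟨τ, hτ⟩ : A.Nonempty := by
      rw [Finset.nonempty_iff_ne_empty]
      rintro rfl
      simp at hd
    exact ⟨_, hu τ hτ⟩
  have hvu := h₁₂.realForm_eq_zero hv hP hP2 huP hu0 hu
  obtain ⟨A, ω, u', -, -, -, -, hd, hu', -⟩ := h₁₁.exists_rays hP hP2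
  suffices h : ∀ τ ∈ A, (TRFunction.max v).toFun (toReal n (u' τ)) = 0 by
    rw [Finset.sum_eq_zero fun τ hτ => by rw [h τ hτ, mul_zero]] at hd
    simp at hd
  intro τ hτ
  obtain ⟨haP, ha0, ha⟩ := hu' τ hτ
  by_cases hspan : toReal n (u' τ) ∈ Submodule.span ℝ {u}
  · obtain ⟨c, hc⟩ := Submodule.mem_span_singleton.1 hspan
    exact max_eq_zero fun i => by rw [← hc, map_smul, hvu, smul_zero]
  obtain ⟨f, hfu, hfa, hf⟩ := exists_coordinate hP2 huP hu0 haP hspan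
  refine absurd ?_ ha
  obtain ⟨i, hi⟩ := exists_eq_max (l := v) (toReal n (u' τ))
  -- Where `f > 0`, every `v j` takes `f y` times its value at `u' τ`, so the form attaining the
  -- maximum there attains it throughout.
  refine ⟨realForm (v i), ?_⟩
  have hcont : Continuous f := f.continuous_of_finiteDimensional
  have hpos : ∀ᶠ y in 𝓝 (toReal n (u' τ)), 0 < f y :=
    hcont.continuousAt.eventually (lt_mem_nhds (by rw [hfa]; exact one_pos))
  filter_upwards [self_mem_nhdsWithin, nhdsWithin_le_nhds hpos] with y hyP hy
  obtain ⟨α, hα⟩ := hf y hyP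
  have hvy : ∀ j, realForm (v j) y = f y * realForm (v j) (toReal n (u' τ)) := by
    intro j
    conv_lhs => rw [hα]
    rw [map_add, map_smul, map_smul, hvu, smul_zero, zero_add, smul_eq_mul]
  refine le_antisymm ?_ (le_max i y)
  obtain ⟨j, hj⟩ := exists_eq_max (l := v) y
  rw [hj, hvy, hvy, ← hi]
  exact mul_le_mul_of_nonneg_left (le_max j _) hy.le

/-- The lattice vectors on which the forms `v` vanish and the forms `w` are small. -/
def smallVectors (v : Fin (k + 1) → Module.Dual ℤ (Fin n → ℤ))
    (w : Fin (m + 1) → Module.Dual ℤ (Fin n → ℤ)) : Set (Fin n → ℤ) :=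
  {z | (∀ i, realForm (v i) (toReal n z) = 0) ∧ ∀ j, w j z ∈ Set.Icc (-1) 1}

/-- The values of the `w j` lie in a finite box and determine a vector killed by all `v i`. -/
theorem finite_smallVectors
    (hvw : ∀ x : Fin n → ℝ, (∀ i, realForm (v i) x = 0) → (∀ j, realForm (w j) x = 0) → x = 0) :
    (smallVectors v w).Finite := by
  refine Set.Finite.of_injOn (f := fun z j => w j z) (t := Set.Icc (fun _ => -1) (fun _ => 1))
    ?_ ?_ (Set.finite_Icc _ _)
  · intro z hz
    exact ⟨fun j => (hz.2 j).1, fun j => (hz.2 j).2⟩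
  · intro z hz z' hz' h
    refine toReal_injective n (sub_eq_zero.1 (hvw _ (fun i => ?_) fun j => ?_))
    · rw [map_sub, hz.1, hz'.1, sub_zero]
    · have hj : w j z = w j z' := congrFun h j
      rw [map_sub, realForm_toReal, realForm_toReal, hj, sub_self]

/-- The vectors are generators of two independent rays of the corner locus of `max w`. A corner
locus inside a single line would force `max w` to vanish on it, contradicting the intersection
number one. -/
theorem exists_span_smallVectors (hv : v 0 = 0) (hw : w 0 = 0) {L : Cycle n 2}
    {P : Submodule ℝ (Fin n → ℝ)} (hP2 : Module.finrank ℝ P = 2) (hP : L.support = P)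
    (h₁₂ : HasIntersectionNumber (TRFunction.max v) (TRFunction.max w) L 0)
    (h₂₂ : HasIntersectionNumber (TRFunction.max w) (TRFunction.max w) L 1) :
    ∃ a ∈ smallVectors v w, ∃ b ∈ smallVectors v w,
      Submodule.span ℝ {toReal n a, toReal n b} = P := by
  obtain ⟨A, ω, u, -, -, hω, hs, hd, hu, hN, -⟩ := h₂₂.exists_rays hP hP2
  have hω1 : ∀ τ ∈ A, (1 : ℝ) ≤ ω τ := fun τ hτ => by
    exact_mod_cast Nat.one_le_iff_ne_zero.2 (hω τ hτ)
  have hnn : ∀ τ ∈ A, 0 ≤ (ω τ : ℝ) * (TRFunction.max w).toFun (toReal n (u τ)) := fun τ _ =>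
    mul_nonneg (Nat.cast_nonneg _) (max_nonneg hw _)
  rw [Nat.cast_one] at hd
  have hsmall : ∀ τ ∈ A, u τ ∈ smallVectors v w := by
    classical
    intro τ hτ
    obtain ⟨h1, h2, h3⟩ := hu τ hτ
    refine ⟨h₁₂.realForm_eq_zero hv hP hP2 h1 h2 h3, fun j => ?_⟩
    have hT0 := max_nonneg hw (toReal n (u τ))
    have hup : realForm (w j) (toReal n (u τ)) ≤ 1 := by
      have h4 := Finset.single_le_sum hnn hτ
      rw [hd] at h4
      have h5 := le_max (l := w) j (toReal n (u τ))
      nlinarith [hω1 τ hτ]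
    -- By balancing, the weighted value at `u τ` is minus the sum over the other rays, and that sum
    -- is at most their contribution to the intersection number, hence at most `1`.
    have hlow : -1 ≤ realForm (w j) (toReal n (u τ)) := by
      have h4 := congrArg (realForm (w j)) hs
      rw [map_sum, map_zero, ← Finset.add_sum_erase _ _ hτ] at h4
      rw [← Finset.add_sum_erase _ _ hτ] at hd
      have h5 : ∑ τ ∈ A.erase τ, realForm (w j) ((ω τ : ℝ) • toReal n (u τ)) ≤
          ∑ τ ∈ A.erase τ, (ω τ : ℝ) * (TRFunction.max w).toFun (toReal n (u τ)) := by
        refine Finset.sum_le_sum fun τ' _ => ?_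
        rw [map_smul, smul_eq_mul]
        exact mul_le_mul_of_nonneg_left (le_max j _) (Nat.cast_nonneg _)
      rw [map_smul, smul_eq_mul] at h4
      have h6 := hnn τ hτ
      by_contra! hlt
      nlinarith [hω1 τ hτ]
    rw [realForm_toReal] at hup hlow
    exact ⟨by exact_mod_cast hlow, by exact_mod_cast hup⟩
  obtain ⟨τ₁, hτ₁⟩ : A.Nonempty := by
    rw [Finset.nonempty_iff_ne_empty]
    rintro rfl
    simp at hd
  set u₁ := toReal n (u τ₁) with hu₁
  obtain ⟨hu₁P, hu₁0, -⟩ := hu τ₁ hτ₁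
  obtain ⟨τ₂, hτ₂, hspan⟩ : ∃ τ ∈ A, toReal n (u τ) ∉ Submodule.span ℝ {u₁} := by
    by_contra! hall
    obtain ⟨a, haP, hau⟩ : ∃ a ∈ P, a ∉ Submodule.span ℝ {u₁} := by
      by_contra! hc
      have h1 := Submodule.finrank_mono (show P ≤ Submodule.span ℝ {u₁} from hc)
      rw [finrank_span_singleton hu₁0] at h1
      omega
    obtain ⟨f, hfu, hfa, -⟩ := exists_coordinate hP2 hu₁P hu₁0 haP hau
    have hf0 : ∀ x ∈ Submodule.span ℝ {u₁}, f x = 0 := by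
      intro x hx
      obtain ⟨c, rfl⟩ := Submodule.mem_span_singleton.1 hx
      rw [map_smul, hfu, smul_zero]
    -- If all corners lie on the line of `u₁`, the maximum is a single form `g` on this open
    -- half-plane. Tending to the boundary line gives `max w ≤ g` there, and comparing `x` with `-x`
    -- kills all `w j` on the rays.
    have hU : IsPreconnected ((P : Set (Fin n → ℝ)) ∩ {y | 0 < f y}) :=
      (P.convex.inter (convex_halfSpace_gt f.isLinear 0)).isPreconnected
    obtain ⟨g, hg⟩ := exists_dual_of_locallyLinearAt (T := (TRFunction.max w).toFun) (x₀ := a) hU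
      Set.inter_subset_left (fun y hy => by
        by_contra hn
        have hy0 : y ≠ 0 := by
          rintro rfl
          have := hy.2
          simp at this
        obtain ⟨τ, hτ, r, -, rfl⟩ := hN y hy.1 hy0 hn
        have h1 := hy.2
        rw [Set.mem_ofPred_eq, map_smul, hf0 _ (hall τ hτ), smul_zero] at h1
        exact lt_irrefl _ h1) ⟨haP, by rw [Set.mem_ofPred_eq, hfa]; exact one_pos⟩
    have hle : ∀ x ∈ P, f x = 0 → (TRFunction.max w).toFun x ≤ g x := by
      intro x hx hfx
      obtain ⟨j, hj⟩ := exists_eq_max (l := w) x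
      rw [hj]
      have h1 : ∀ t : ℝ, 0 < t →
          realForm (w j) x + t * realForm (w j) a ≤ g x + t * g a := by
        intro t ht
        have h2 := hg (x + t • a) ⟨add_mem hx (P.smul_mem t haP), by
          rw [Set.mem_ofPred_eq, map_add, map_smul, hfx, hfa]; simpa using ht⟩
        have h3 := le_max (l := w) j (x + t • a)
        rwa [h2, map_add, map_add, map_smul, map_smul, smul_eq_mul, smul_eq_mul] at h3
      have h4 : Tendsto (fun t : ℝ => g x + t * g a - t * realForm (w j) a) (𝓝[>] 0)
          (𝓝 (g x)) := by
        have : Continuous fun t : ℝ => g x + t * g a - t * realForm (w j) a := by fun_prop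
        have h5 := this.tendsto 0
        rw [zero_mul, zero_mul, add_zero, sub_zero] at h5
        exact h5.mono_left nhdsWithin_le_nhds
      refine ge_of_tendsto h4 ?_
      filter_upwards [self_mem_nhdsWithin] with t ht
      linarith [h1 t ht]
    have hzero : ∀ τ ∈ A, (TRFunction.max w).toFun (toReal n (u τ)) = 0 := by
      intro τ hτ
      have hτP := (hu τ hτ).1
      have h1 := hle _ hτP (hf0 _ (hall τ hτ))
      have h2 := hle _ (P.neg_mem hτP) (by rw [map_neg, hf0 _ (hall τ hτ), neg_zero])
      refine max_eq_zero (realForm_eq_zero_of_max_add_max_neg_le hw ?_)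
      rw [map_neg] at h2
      linarith
    rw [Finset.sum_eq_zero fun τ hτ => by rw [hzero τ hτ, mul_zero]] at hd
    exact zero_ne_one hd
  refine ⟨u τ₁, hsmall τ₁ hτ₁, u τ₂, hsmall τ₂ hτ₂, le_antisymm ?_ fun x hx => ?_⟩
  · rw [Submodule.span_le, Set.insert_subset_iff, Set.singleton_subset_iff]
    exact ⟨hu₁P, (hu τ₂ hτ₂).1⟩
  · obtain ⟨α, β, rfl⟩ := WeightedFan.exists_eq_add_smul hP2 hu₁0 hu₁P (hu τ₂ hτ₂).1 hx hspan
    exact Submodule.mem_span_pair.2 ⟨α, β, rfl⟩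

/-- The constant weight `c` divides every ray weight of `T · L`, and `S` is integral on lattice
vectors, so `c` divides the intersection number `1`. -/
theorem exists_representative_of_hasIntersectionNumber_one {S T : TRFunction n} {L : Cycle n 2}
    {P : Submodule ℝ (Fin n → ℝ)} (hP2 : Module.finrank ℝ P = 2) (hP : L.support = P)
    (h : HasIntersectionNumber S T L 1) :
    ∃ F : TropicalFan n 2, F.cycle = L ∧ ∀ σ ∈ F.activeFacets, F.weight σ = 1 := by
  obtain ⟨A, ω, u, c, F, -, -, hd, -, -, hF, -, hc, hdvd⟩ := h.exists_rays hP hP2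
  refine ⟨F, hF, ?_⟩
  choose a ha using S.exists_int
  have h1 : ∑ τ ∈ A, (ω τ : ℤ) * a (u τ) = 1 := by
    simp only [ha] at hd
    exact_mod_cast hd
  have h2 : (c : ℤ) ∣ 1 := by
    rw [← h1]
    exact Finset.dvd_sum fun τ hτ => (Int.natCast_dvd_natCast.2 (hdvd τ hτ)).mul_right _
  have h3 : c = 1 := Nat.dvd_one.1 (by exact_mod_cast h2)
  rw [← h3]
  exact hc

/-- The support map is injective on these cycles because their weight is one, and its values are
spans of pairs from a finite set. -/
theorem finite_zero_zero_one (hv : v 0 = 0) (hw : w 0 = 0)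
    (hvw : ∀ x : Fin n → ℝ, (∀ i, realForm (v i) x = 0) → (∀ j, realForm (w j) x = 0) → x = 0) :
    {L : Cycle n 2 | L.SupportIsPlane ∧
      HasIntersectionNumber (TRFunction.max v) (TRFunction.max w) L 0 ∧
      HasIntersectionNumber (TRFunction.max w) (TRFunction.max w) L 1}.Finite := by
  have hfin := finite_smallVectors hvw
  refine Set.Finite.of_injOn (f := Cycle.support)
    (t := Set.image2 (fun a b => (Submodule.span ℝ {toReal n a, toReal n b} : Set (Fin n → ℝ)))
      (smallVectors v w) (smallVectors v w)) ?_ ?_ (hfin.image2 _ hfin)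
  · rintro L ⟨⟨P, hP2, hP⟩, h₁₂, h₂₂⟩
    obtain ⟨a, ha, b, hb, hab⟩ := exists_span_smallVectors hv hw hP2 hP h₁₂ h₂₂
    exact ⟨a, ha, b, hb, by rw [hP, ← hab]⟩
  · rintro L ⟨⟨P, hP2, hP⟩, -, h₂₂⟩ L' ⟨-, -, h₂₂'⟩ hLL'
    have hP' : L'.support = P := by rw [← hP, hLL']
    obtain ⟨F, rfl, hFw⟩ := exists_representative_of_hasIntersectionNumber_one hP2 hP h₂₂
    obtain ⟨G, rfl, hGw⟩ := exists_representative_of_hasIntersectionNumber_one hP2 hP' h₂₂'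
    exact TropicalFan.cycle_eq hP2 hP hP' hFw hGw

end Final

end Tropical4

theorem lemma4p7 (n k m : ℕ) (hn : k + m = n)
    (v : Fin (k + 1) → Module.Dual ℤ (Fin n → ℤ)) (w : Fin (m + 1) → Module.Dual ℤ (Fin n → ℤ))
    (hv : v 0 = 0) (hw : w 0 = 0)
    (hvw : LinearIndependent ℤ
      (Sum.elim (fun i : Fin k => v i.succ) (fun j : Fin m => w j.succ)))
    (T₁ T₂ : Tropical4.TRFunction n)
    (hT₁ : T₁ = Tropical4.TRFunction.max v) (hT₂ : T₂ = Tropical4.TRFunction.max w) :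
    {L : Tropical4.Cycle n 2 | L.SupportIsPlane ∧
      Tropical4.HasIntersectionNumber T₁ T₂ L 0 ∧
      Tropical4.HasIntersectionNumber T₁ T₁ L 0 ∧
      Tropical4.HasIntersectionNumber T₂ T₂ L 1}.Finite ∧
    (¬ ∃ L : Tropical4.Cycle n 2, L.SupportIsPlane ∧
      Tropical4.HasIntersectionNumber T₁ T₂ L 0 ∧
      Tropical4.HasIntersectionNumber T₁ T₁ L 0 ∧
      Tropical4.HasIntersectionNumber T₂ T₂ L 0) ∧
    (¬ ∃ L : Tropical4.Cycle n 2, L.SupportIsPlane ∧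
      Tropical4.HasIntersectionNumber T₁ T₂ L 0 ∧
      Tropical4.HasIntersectionNumber T₁ T₁ L 1 ∧
      Tropical4.HasIntersectionNumber T₂ T₂ L 1) := by
  subst hn hT₁ hT₂
  have hinj : ∀ x : Fin (k + m) → ℝ, (∀ i, Tropical4.realForm (v i) x = 0) →
      (∀ j, Tropical4.realForm (w j) x = 0) → x = 0 := fun x hx hx' =>
    Tropical4.eq_zero_of_linearIndependent hvw (by
      rintro (i | j)
      · exact hx _
      · exact hx' _)
  refine ⟨?_, ?_, ?_⟩
  · exact (Tropical4.finite_zero_zero_one hv hw hinj).subset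
      fun L ⟨hL, h₁₂, _, h₂₂⟩ => ⟨hL, h₁₂, h₂₂⟩
  · rintro ⟨L, hL, h₁₂, h₁₁, h₂₂⟩
    exact Tropical4.not_exists_zero_zero_zero hv hw hinj hL h₁₂ h₁₁ h₂₂
  · rintro ⟨L, hL, h₁₂, h₁₁, h₂₂⟩
    exact Tropical4.not_exists_zero_one_one hv hL h₁₂ h₁₁ h₂₂
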